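/- A \emph{commutative residuated lattice} (CRL) is an algebra $\langle A,\vee,\wedge,\cdot,\to,1\rangle$ such that $\langle A,\vee,\wedge\rangle$ is a lattice, $\langle A,\cdot,1\rangle$ is a commutative monoid, and $ab\le c \iff a\le b\to c$. It is \emph{integral} if $1$ is its largest element, and \emph{cancellative} if its monoid is cancellative. A \emph{cancellative hoop} is a cancellative integral CRL satisfying $x(x\to y)=y(y\to x)$; $\mathsf C$ is the class of cancellative hoops. $\mathbf C_\omega$ is the cancellative hoop on the chain $1=a^0>a>a^2>\cdots$ with $a^ra^s=a^{r+s}$ and $a^r\to a^s=a^{\max\{s-r,0\}}$. Put $\neg x=x\to 1$. A \emph{K-lattice} is a CRL such that $\neg\neg x=x$, both lattice distributive laws hold whenever at least one of the three elements involved is $1$, and $xy\wedge 1=(x\wedge 1)(y\wedge 1)$ and $((x\wedge 1)\to y)\wedge((\neg y\wedge 1)\to\neg x)=x\to y$ hold for all $x,y$. $\mathsf{KL}$ is the variety of K-lattices, and $\Lambda(\mathsf{KL})$ is its lattice of subvarieties, ordered by inclusion. Let $\mathbb V(\mathcal S)$ denote the variety generated by the class $\mathcal S$. The \emph{negative cone}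 $A^-$ of a CRL $A$ is the integral CRL on $\{a\in A: a\le 1\}$ with the operations of $A$, except that its residual is $(a\to b)\wedge 1$. For an integral CRL $A$, $K(A)$ is the CRL on $A\times A$ with unit $(1,1)$ and $$(a,b)\vee(c,d)=(a\vee c,b\wedge d),\qquad (a,b)\wedge(c,d)=(a\wedge c,b\vee d),$$ $$(a,b)(c,d)=(ac,(a\to d)\wedge(c\to b)),\qquad (a,b)\to(c,d)=((a\to c)\wedge(d\to b),ad).$$ For a class $\mathcal V$ of integral CRLs, $K(\mathcal V)$ is the class of K-lattices that embed in $K(L)$ for some $L\in\mathcal V$. For a class $\mathcal W$ of K-lattices, $\mathcal W^-=\mathbb V(\{A^-:A\in\mathcal W\})$. A subvariety $\mathcal W$ of $\mathsf{KL}$ is a \emph{Kalman variety} if $\mathcal W=K(\mathcal W^-)$. \textbf{Theorem.} \begin{enumerate} \item $K(\mathsf C)$ is a subvariety of $\mathsf{KL}$ and a Kalman variety, $K(\mathsf C)=\mathbb V(K(\mathbf C_\omega))$, and $K(\mathsf C)$ is an atom of $\Lambda(\mathsf{KL})$. It is not finitely generated, that is, it is not generated by any finite set of finite algebras. \item If $A$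 is a K-lattice whose negative cone $A^-$ is cancellative, then $a\mapsto(a\wedge 1,\neg a\wedge 1)$ is an isomorphism of $A$ onto $K(A^-)$. \item $\mathbf C_\omega$ embeds in every nontrivial totally ordered cancellative hoop. \end{enumerate} -/

import Mathlib

universe u

namespace KLat

/-! ### Commutative residuated lattices -/

/-- A commutative residuated lattice: a lattice and a commutative monoid, with the residual
`b ⇨ c` of multiplication. -/
class CRL (A : Type u) extends Lattice A, CommMonoid A, HImp A where
  /-- `(·, ⇨)` is a residuated pair. -/
  mul_le_iff : ∀ a b c : A, a * b ≤ c ↔ a ≤ b ⇨ c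

/-- Integrality: `1` is the largest element. -/
class Integral (A : Type u) [CRL A] : Prop where
  le_one : ∀ a : A, a ≤ 1

/-- Homomorphisms of commutative residuated lattices (all basic operations are preserved). -/
structure IsHom {A B : Type u} [CRL A] [CRL B] (f : A → B) : Prop where
  map_sup : ∀ x y, f (x ⊔ y) = f x ⊔ f y
  map_inf : ∀ x y, f (x ⊓ y) = f x ⊓ f y
  map_mul : ∀ x y, f (x * y) = f x * f y
  map_himp : ∀ x y, f (x ⇨ y) = f x ⇨ f y
  map_one : f 1 = 1

section basic
variable {A : Type u} [CRL A]

theorem himp_mul_le (a b : A) : (a ⇨ b) * a ≤ b := (CRL.mul_le_iff _ _ _).2 le_rfl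

theorem mul_mono_left {a b : A} (h : a ≤ b) (c : A) : a * c ≤ b * c :=
  (CRL.mul_le_iff _ _ _).2 (h.trans ((CRL.mul_le_iff _ _ _).1 le_rfl))

theorem mul_mono {a b c d : A} (h : a ≤ b) (k : c ≤ d) : a * c ≤ b * d :=
  (mul_mono_left h c).trans (by
    rw [mul_comm b c, mul_comm b d]
    exact mul_mono_left k b)

theorem mul_himp (a b c : A) : (a * b) ⇨ c = a ⇨ (b ⇨ c) :=
  eq_of_forall_le_iff fun z => by
    rw [← CRL.mul_le_iff, ← CRL.mul_le_iff, ← CRL.mul_le_iff, mul_assoc]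

theorem himp_inf (a b c : A) : a ⇨ (b ⊓ c) = (a ⇨ b) ⊓ (a ⇨ c) :=
  eq_of_forall_le_iff fun z => by
    rw [le_inf_iff, ← CRL.mul_le_iff, ← CRL.mul_le_iff, ← CRL.mul_le_iff, le_inf_iff]

theorem one_himp (a : A) : (1 : A) ⇨ a = a :=
  eq_of_forall_le_iff fun z => by rw [← CRL.mul_le_iff, mul_one]

theorem himp_one [Integral A] (a : A) : a ⇨ (1 : A) = 1 :=
  le_antisymm (Integral.le_one _) ((CRL.mul_le_iff _ _ _).1 (Integral.le_one _))

end basic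

/-- Direct products, with componentwise operations. -/
instance instPi {ι : Type u} (A : ι → Type u) [∀ i, CRL (A i)] : CRL (∀ i, A i) :=
  { (inferInstance : Lattice (∀ i, A i)), (inferInstance : CommMonoid (∀ i, A i)) with
    himp := fun f g i => f i ⇨ g i
    mul_le_iff := fun a b c => forall_congr' fun i => CRL.mul_le_iff (a i) (b i) (c i) }

/-! ### The negative cone -/

/-- The set `A⁻ = {a : a ≤ 1}`. -/
@[ext] structure NegCone (A : Type u) [CRL A] : Type u where
  val : A
  le_one : val ≤ 1

namespace NegCone
variable {A : Type u} [CRL A]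

instance : PartialOrder (NegCone A) :=
  PartialOrder.lift (fun a : NegCone A => a.val) fun _ _ h => NegCone.ext h

/-- The residuated lattice `A⁻`: the operations are those of `A`, except that the residual is
`a ⇨₁ b = (a ⇨ b) ⊓ 1`. -/
instance : CRL (NegCone A) where
  sup a b := ⟨a.val ⊔ b.val, sup_le a.le_one b.le_one⟩
  le_sup_left a b := show a.val ≤ a.val ⊔ b.val from le_sup_left
  le_sup_right a b := show b.val ≤ a.val ⊔ b.val from le_sup_right
  sup_le a b c h k := show a.val ⊔ b.val ≤ c.val from sup_le h k
  inf a b := ⟨a.val ⊓ b.val, inf_le_left.trans a.le_one⟩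
  inf_le_left a b := show a.val ⊓ b.val ≤ a.val from inf_le_left
  inf_le_right a b := show a.val ⊓ b.val ≤ b.val from inf_le_right
  le_inf a b c h k := show a.val ≤ b.val ⊓ c.val from le_inf h k
  mul a b := ⟨a.val * b.val, (mul_mono a.le_one b.le_one).trans (mul_one (1 : A)).le⟩
  mul_assoc a b c := NegCone.ext (mul_assoc a.val b.val c.val)
  mul_comm a b := NegCone.ext (mul_comm a.val b.val)
  one := ⟨1, le_rfl⟩
  one_mul a := NegCone.ext (one_mul a.val)
  mul_one a := NegCone.ext (mul_one a.val)
  himp a b := ⟨(a.val ⇨ b.val) ⊓ 1, inf_le_right⟩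
  mul_le_iff a b c := by
    change a.val * b.val ≤ c.val ↔ a.val ≤ (b.val ⇨ c.val) ⊓ 1
    rw [le_inf_iff, CRL.mul_le_iff]
    exact ⟨fun h => ⟨h, a.le_one⟩, fun h => h.1⟩

instance : Integral (NegCone A) := ⟨fun a => a.le_one⟩

end NegCone

/-! ### The K-expansion -/

/-- The universe `A × A` of the K-expansion `K(A)`. -/
@[ext] structure KExp (A : Type u) : Type u where
  fst : A
  snd : A

namespace KExp
variable {A : Type u} [CRL A]

/-- `(a, b) ≤ (c, d)` iff `a ≤ c` and `d ≤ b`; this is the order of the lattice operations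
of `K(A)`. -/
instance : PartialOrder (KExp A) where
  le x y := x.fst ≤ y.fst ∧ y.snd ≤ x.snd
  le_refl _ := ⟨le_rfl, le_rfl⟩
  le_trans _ _ _ h k := ⟨h.1.trans k.1, k.2.trans h.2⟩
  le_antisymm _ _ h k := KExp.ext (le_antisymm h.1 k.1) (le_antisymm k.2 h.2)

/-- The K-expansion `K(A)` of an integral commutative residuated lattice `A`. -/
instance [Integral A] : CRL (KExp A) where
  sup x y := ⟨x.fst ⊔ y.fst, x.snd ⊓ y.snd⟩
  le_sup_left _ _ := ⟨le_sup_left, inf_le_left⟩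
  le_sup_right _ _ := ⟨le_sup_right, inf_le_right⟩
  sup_le _ _ _ h k := ⟨sup_le h.1 k.1, le_inf h.2 k.2⟩
  inf x y := ⟨x.fst ⊓ y.fst, x.snd ⊔ y.snd⟩
  inf_le_left _ _ := ⟨inf_le_left, le_sup_left⟩
  inf_le_right _ _ := ⟨inf_le_right, le_sup_right⟩
  le_inf _ _ _ h k := ⟨le_inf h.1 k.1, sup_le h.2 k.2⟩
  mul x y := ⟨x.fst * y.fst, (x.fst ⇨ y.snd) ⊓ (y.fst ⇨ x.snd)⟩
  one := ⟨1, 1⟩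
  himp x y := ⟨(x.fst ⇨ y.fst) ⊓ (y.snd ⇨ x.snd), x.fst * y.snd⟩
  mul_assoc x y z := by
    refine KExp.ext (mul_assoc x.fst y.fst z.fst) ?_
    change ((x.fst * y.fst) ⇨ z.snd) ⊓ (z.fst ⇨ ((x.fst ⇨ y.snd) ⊓ (y.fst ⇨ x.snd)))
      = (x.fst ⇨ ((y.fst ⇨ z.snd) ⊓ (z.fst ⇨ y.snd))) ⊓ ((y.fst * z.fst) ⇨ x.snd)
    rw [himp_inf, himp_inf, mul_himp, ← mul_himp z.fst x.fst, mul_comm z.fst x.fst,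
      mul_himp x.fst z.fst, ← mul_himp z.fst y.fst, mul_comm z.fst y.fst, inf_assoc]
  mul_comm x y := KExp.ext (mul_comm x.fst y.fst) (inf_comm _ _)
  one_mul x := KExp.ext (one_mul x.fst) (by
    change ((1 : A) ⇨ x.snd) ⊓ (x.fst ⇨ (1 : A)) = x.snd
    rw [one_himp, himp_one, inf_eq_left.2 (Integral.le_one _)])
  mul_one x := KExp.ext (mul_one x.fst) (by
    change (x.fst ⇨ (1 : A)) ⊓ ((1 : A) ⇨ x.snd) = x.snd
    rw [one_himp, himp_one, inf_eq_right.2 (Integral.le_one _)])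
  mul_le_iff x y z := by
    change (x.fst * y.fst ≤ z.fst ∧ z.snd ≤ (x.fst ⇨ y.snd) ⊓ (y.fst ⇨ x.snd)) ↔
      (x.fst ≤ (y.fst ⇨ z.fst) ⊓ (z.snd ⇨ y.snd) ∧ y.fst * z.snd ≤ x.snd)
    rw [le_inf_iff, le_inf_iff, ← CRL.mul_le_iff, ← CRL.mul_le_iff, ← CRL.mul_le_iff,
      ← CRL.mul_le_iff, mul_comm z.snd x.fst, mul_comm z.snd y.fst]
    tauto

end KExp

/-! ### The algebra `C_ω` -/

/-- The universe of `C_ω`: the powers `a ^ n` of the generator `a` of the free monoid on one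
generator. The element `a ^ n` is `⟨n⟩`. -/
@[ext] structure COmega : Type u where
  exp : ℕ

namespace COmega

/-- The chain `1 = a ^ 0 > a > a ^ 2 > ⋯`. -/
instance : PartialOrder COmega.{u} where
  le x y := y.exp ≤ x.exp
  le_refl _ := le_refl (α := ℕ) _
  le_trans _ _ _ h k := le_trans (α := ℕ) k h
  le_antisymm _ _ h k := COmega.ext (le_antisymm (α := ℕ) k h)

/-- `a ^ r * a ^ s = a ^ (r + s)` and `a ^ r ⇨ a ^ s = a ^ max (s - r, 0)`. -/
instance : CRL COmega.{u} where
  sup x y := ⟨min x.exp y.exp⟩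
  le_sup_left x y := show min x.exp y.exp ≤ x.exp from min_le_left _ _
  le_sup_right x y := show min x.exp y.exp ≤ y.exp from min_le_right _ _
  sup_le x y z h k := show z.exp ≤ min x.exp y.exp from le_min h k
  inf x y := ⟨max x.exp y.exp⟩
  inf_le_left x y := show x.exp ≤ max x.exp y.exp from le_max_left _ _
  inf_le_right x y := show y.exp ≤ max x.exp y.exp from le_max_right _ _
  le_inf x y z h k := show max y.exp z.exp ≤ x.exp from max_le h k
  mul x y := ⟨x.exp + y.exp⟩
  one := ⟨0⟩
  himp x y := ⟨y.exp - x.exp⟩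
  mul_assoc x y z := COmega.ext (add_assoc x.exp y.exp z.exp)
  mul_comm x y := COmega.ext (add_comm x.exp y.exp)
  one_mul x := COmega.ext (zero_add x.exp)
  mul_one x := COmega.ext (add_zero x.exp)
  mul_le_iff x y z := by
    change z.exp ≤ x.exp + y.exp ↔ z.exp - y.exp ≤ x.exp
    omega

instance : Integral COmega.{u} := ⟨fun x => Nat.zero_le x.exp⟩

end COmega

/-! ### K-lattices and cancellative hoops -/

/-- `¬x = x ⇨ 1`. -/
def neg {A : Type u} [CRL A] (x : A) : A := x ⇨ 1

/-- Kalman lattices: `1`-involutive and `1`-distributive commutative residuated lattices that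
satisfy (K1) and (K2). -/
structure IsKLattice (A : Type u) [CRL A] : Prop where
  one_involutive : ∀ b : A, (b ⇨ 1) ⇨ 1 = b
  one_distrib_inf : ∀ x y z : A, (x = 1 ∨ y = 1 ∨ z = 1) → x ⊓ (y ⊔ z) = (x ⊓ y) ⊔ (x ⊓ z)
  one_distrib_sup : ∀ x y z : A, (x = 1 ∨ y = 1 ∨ z = 1) → x ⊔ (y ⊓ z) = (x ⊔ y) ⊓ (x ⊔ z)
  k1 : ∀ x y : A, (x * y) ⊓ 1 = (x ⊓ 1) * (y ⊓ 1)
  k2 : ∀ x y : A, ((x ⊓ 1) ⇨ y) ⊓ ((neg y ⊓ 1) ⇨ neg x) = x ⇨ y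

/-- A commutative residuated lattice is cancellative if its underlying monoid is. -/
def Cancellative (A : Type u) [CRL A] : Prop := ∀ a b c : A, a * b = a * c → b = c

/-- Cancellative hoops: integral, divisible (equation (D)) and cancellative. -/
structure IsCancHoop (A : Type u) [CRL A] : Prop where
  integral : Integral A
  divisible : ∀ x y : A, x * (x ⇨ y) = y * (y ⇨ x)
  cancellative : Cancellative A

/-! ### Classes of algebras and varieties -/

/-- Bundled commutative residuated lattices. -/
structure CRLat : Type (u + 1) where
  carrier : Type u
  [str : CRL carrier]

attribute [instance] CRLat.str

/-- A variety of commutative residuated lattices: a class closed under homomorphic images,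
(isomorphic copies of) subalgebras, and direct products, the empty one included. -/
structure IsVariety (W : Set CRLat.{u}) : Prop where
  image : ∀ A B : CRLat.{u}, A ∈ W →
    (∃ f : A.carrier → B.carrier, IsHom f ∧ Function.Surjective f) → B ∈ W
  sub : ∀ A B : CRLat.{u}, B ∈ W →
    (∃ f : A.carrier → B.carrier, IsHom f ∧ Function.Injective f) → A ∈ W
  prod : ∀ (ι : Type u) (A : ι → CRLat.{u}), (∀ i, A i ∈ W) →
    (⟨∀ i, (A i).carrier⟩ : CRLat.{u}) ∈ W

/-- The variety `V(S)` generated by a class `S`: the smallest variety that contains `S`. -/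
def Var (S : Set CRLat.{u}) : Set CRLat.{u} :=
  {A | ∀ W : Set CRLat.{u}, IsVariety W → S ⊆ W → A ∈ W}

/-- A variety is finitely generated if it is generated by finitely many finite algebras. -/
def FinitelyGenerated (W : Set CRLat.{u}) : Prop :=
  ∃ S : Set CRLat.{u}, S.Finite ∧ (∀ A ∈ S, Finite A.carrier) ∧ W = Var S

/-- The class `KL` of K-lattices. -/
def KL : Set CRLat.{u} := {A | IsKLattice A.carrier}

/-- The class `C` of cancellative hoops. -/
def CancHoops : Set CRLat.{u} := {A | IsCancHoop A.carrier}

/-- `K(V)`: the K-lattices that embed in `K(L)` for some (integral) `L ∈ V`. -/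
def KClass (V : Set CRLat.{u}) : Set CRLat.{u} :=
  {A | A ∈ KL ∧ ∃ L ∈ V, ∃ _ : Integral L.carrier,
    ∃ f : A.carrier → KExp L.carrier, IsHom f ∧ Function.Injective f}

/-- `W⁻`: the variety generated by the negative cones of the members of `W`. -/
def NegClass (W : Set CRLat.{u}) : Set CRLat.{u} :=
  Var {B | ∃ A ∈ W, B = ⟨NegCone A.carrier⟩}

/-- Kalman varieties: `W = K(W⁻)`. -/
def IsKalman (W : Set CRLat.{u}) : Prop := W = KClass (NegClass W)

/-- The members of `Λ(KL)`: the subvarieties of `KL`. -/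
@[ext] structure SubKL : Type (u + 1) where
  carrier : Set CRLat.{u}
  isVariety : IsVariety carrier
  le_KL : carrier ⊆ KL

/-- `Λ(KL)` is ordered by inclusion. -/
instance : PartialOrder SubKL.{u} :=
  PartialOrder.lift SubKL.carrier fun _ _ h => SubKL.ext h

/-- The class of trivial (one-element) algebras. -/
def Triv : Set CRLat.{u} := {A | Subsingleton A.carrier}

theorem isVariety_triv : IsVariety Triv.{u} where
  image := by
    rintro A B hA ⟨f, _, hf⟩
    have : Subsingleton A.carrier := hA
    exact hf.subsingleton
  sub := by
    rintro A B hB ⟨f, _, hf⟩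
    have : Subsingleton B.carrier := hB
    exact hf.subsingleton
  prod := by
    intro ι A hA
    have : ∀ i, Subsingleton (A i).carrier := hA
    exact (inferInstance : Subsingleton (∀ i, (A i).carrier))

theorem triv_subset {W : Set CRLat.{u}} (hW : IsVariety W) : Triv ⊆ W := by
  intro A hA
  have : Subsingleton A.carrier := hA
  refine hW.sub A _ (hW.prod PEmpty (fun i => i.elim) (fun i => i.elim)) ⟨fun _ i => i.elim, ?_, ?_⟩
  · constructor <;> intros <;> funext i <;> exact i.elim
  · exact fun x y _ => Subsingleton.elim x y

/-- The least element of `Λ(KL)` is the variety of trivial algebras. -/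
instance : OrderBot SubKL.{u} where
  bot := ⟨Triv, isVariety_triv, fun A hA => by
    have : Subsingleton A.carrier := hA
    constructor <;> intros <;> exact Subsingleton.elim _ _⟩
  bot_le W := triv_subset W.isVariety

end KLat

/-! In any K-lattice `A` the map `a ↦ (a ⊓ 1, ¬a ⊓ 1)` embeds `A` into `K(A⁻)` (`isHom_toKExp`,
`toKExp_injective`). If `A⁻` is cancellative the map is onto, since `p * ¬(p * q)` is sent to `(p,
q)`. Conversely `L ≅ K(L)⁻`. Hence `K(C)` consists of the K-lattices whose negative cone is a
cancellative hoop (`mem_kClass_cancHoops_iff`), and closure under H, S and P reduces to the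
equational description of K-lattices and of cancellative hoops.

A nontrivial `A` in `K(C)` is isomorphic to `K(A⁻)`, and the powers of any `a ≠ 1` in `A⁻` form a
copy of `C_ω`. So `K(C_ω)` embeds in `A` (`kExp_cOmega_mem`). This makes `K(C)` an atom once it is
known that `K(C_ω)` generates it, and it leaves no nontrivial finite member.

Generation is the hard part. In a cancellative hoop, an element other than `1` is omitted by a prime
filter, and dividing the group of fractions by that filter gives a linearly ordered abelian group.
On finitely many elements the order of such a group is reproduced by a homomorphism to `ℤ`, by
Fourier-Motzkin elimination and clearing of denominators. Reading the integers as exponents gives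
maps to `C_ω` that preserve the operations on a given finite set and separate two given points
(`locallySeparated_cOmega`). This local separation passes to K-expansions, and it places an algebra
in HSP of the target (`LocallySeparated.mem_of_isVariety`). -/

namespace KLat

/-! ### Arithmetic of commutative residuated lattices -/

section arith
variable {A : Type u} [CRL A]

theorem le_himp_iff_mul_le {a b c : A} : a ≤ b ⇨ c ↔ a * b ≤ c := (CRL.mul_le_iff a b c).symm

theorem mul_himp_le (a b : A) : a * (a ⇨ b) ≤ b := mul_comm a (a ⇨ b) ▸ himp_mul_le a b

theorem one_le_himp_iff {a b : A} : 1 ≤ a ⇨ b ↔ a ≤ b := by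
  rw [le_himp_iff_mul_le, one_mul]

theorem himp_mono_right {b c : A} (a : A) (h : b ≤ c) : a ⇨ b ≤ a ⇨ c :=
  le_himp_iff_mul_le.2 ((himp_mul_le a b).trans h)

theorem sup_himp (a b c : A) : (a ⊔ b) ⇨ c = (a ⇨ c) ⊓ (b ⇨ c) :=
  eq_of_forall_le_iff fun z => by
    rw [le_inf_iff, le_himp_iff_mul_le, le_himp_iff_mul_le, le_himp_iff_mul_le, mul_comm z,
      mul_comm z, mul_comm z, ← le_himp_iff_mul_le, ← le_himp_iff_mul_le, ← le_himp_iff_mul_le,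
      sup_le_iff]

theorem mul_sup (a b c : A) : a * (b ⊔ c) = a * b ⊔ a * c :=
  eq_of_forall_ge_iff fun z => by
    rw [sup_le_iff, mul_comm, mul_comm a b, mul_comm a c, ← le_himp_iff_mul_le,
      ← le_himp_iff_mul_le, ← le_himp_iff_mul_le, sup_le_iff]

theorem himp_himp_inf_one {u : A} (hu : u ≤ 1) (v : A) : (u ⇨ (v ⊓ 1)) ⊓ 1 = (u ⇨ v) ⊓ 1 := by
  rw [himp_inf, inf_assoc, inf_eq_right.2 (one_le_himp_iff.2 hu)]

theorem mul_le_left_of_le_one {a b : A} (hb : b ≤ 1) : a * b ≤ a := by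
  simpa using mul_mono (le_refl a) hb

end arith

/-! ### Homomorphisms -/

namespace IsHom
variable {A B C : Type u} [CRL A] [CRL B] [CRL C]

theorem comp {g : B → C} {f : A → B} (hg : IsHom g) (hf : IsHom f) : IsHom (g ∘ f) where
  map_sup x y := by simp [hf.map_sup, hg.map_sup]
  map_inf x y := by simp [hf.map_inf, hg.map_inf]
  map_mul x y := by simp [hf.map_mul, hg.map_mul]
  map_himp x y := by simp [hf.map_himp, hg.map_himp]
  map_one := by simp [hf.map_one, hg.map_one]

theorem le_one {f : A → B} (hf : IsHom f) {a : A} (ha : a ≤ 1) : f a ≤ 1 := by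
  rw [← inf_eq_left, ← hf.map_one, ← hf.map_inf, inf_eq_left.2 ha]

theorem map_neg {f : A → B} (hf : IsHom f) (a : A) : f (neg a) = neg (f a) := by
  rw [neg, neg, hf.map_himp, hf.map_one]

end IsHom

theorem isHom_id (A : Type u) [CRL A] : IsHom (id : A → A) := by
  constructor <;> intros <;> rfl

theorem isHom_eval {ι : Type u} (A : ι → Type u) [∀ i, CRL (A i)] (i : ι) :
    IsHom (fun x : ∀ i, A i => x i) := by
  constructor <;> intros <;> rfl

/-- The inverse of a bijective homomorphism is a homomorphism. -/
theorem IsHom.exists_inverse {A B : Type u} [CRL A] [CRL B] {f : A → B} (hf : IsHom f)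
    (hb : Function.Bijective f) : ∃ g : B → A, IsHom g ∧ Function.Bijective g := by
  obtain ⟨g, hl, hr⟩ := Function.bijective_iff_has_inverse.1 hb
  refine ⟨g, ?_, hr.injective, hl.surjective⟩
  constructor <;> intros <;> apply hb.1 <;>
    simp [hf.map_sup, hf.map_inf, hf.map_mul, hf.map_himp, hf.map_one, hr _]

/-! ### Operations of the negative cone and of the K-expansion -/

namespace NegCone
variable {A B : Type u} [CRL A] [CRL B]

@[simp] theorem val_sup (a b : NegCone A) : (a ⊔ b).val = a.val ⊔ b.val := rfl
@[simp] theorem val_inf (a b : NegCone A) : (a ⊓ b).val = a.val ⊓ b.val := rfl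
@[simp] theorem val_mul (a b : NegCone A) : (a * b).val = a.val * b.val := rfl
@[simp] theorem val_himp (a b : NegCone A) : (a ⇨ b).val = (a.val ⇨ b.val) ⊓ 1 := rfl
@[simp] theorem val_one : (1 : NegCone A).val = 1 := rfl

/-- The homomorphism between negative cones induced by a homomorphism. -/
def map (f : A → B) (hf : IsHom f) (a : NegCone A) : NegCone B := ⟨f a.val, hf.le_one a.le_one⟩

theorem isHom_map {f : A → B} (hf : IsHom f) : IsHom (map f hf) where
  map_sup x y := NegCone.ext (hf.map_sup _ _)
  map_inf x y := NegCone.ext (hf.map_inf _ _)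
  map_mul x y := NegCone.ext (hf.map_mul _ _)
  map_himp x y := NegCone.ext (by simp [map, hf.map_inf, hf.map_himp, hf.map_one])
  map_one := NegCone.ext hf.map_one

theorem map_injective {f : A → B} (hf : IsHom f) (h : Function.Injective f) :
    Function.Injective (map f hf) := fun _ _ hxy =>
  NegCone.ext (h (congrArg NegCone.val hxy))

theorem map_surjective {f : A → B} (hf : IsHom f) (h : Function.Surjective f) :
    Function.Surjective (map f hf) := fun y => by
  obtain ⟨x, hx⟩ := h y.val
  -- A preimage of `y` need not lie below `1`; truncating it does not change its image, as `y ≤ 1`.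
  refine ⟨⟨x ⊓ 1, inf_le_right⟩, NegCone.ext ?_⟩
  simp [map, hf.map_inf, hf.map_one, hx, y.le_one]

end NegCone

namespace KExp

/-- The map between K-expansions induced by a map. -/
def map {A B : Type u} (f : A → B) (x : KExp A) : KExp B := ⟨f x.fst, f x.snd⟩

theorem map_injective {A B : Type u} {f : A → B} (h : Function.Injective f) :
    Function.Injective (map f) := fun _ _ hxy =>
  KExp.ext (h (congrArg KExp.fst hxy)) (h (congrArg KExp.snd hxy))

variable {A B : Type u} [CRL A] [Integral A] [CRL B] [Integral B]

@[simp] theorem fst_sup (x y : KExp A) : (x ⊔ y).fst = x.fst ⊔ y.fst := rfl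
@[simp] theorem snd_sup (x y : KExp A) : (x ⊔ y).snd = x.snd ⊓ y.snd := rfl
@[simp] theorem fst_inf (x y : KExp A) : (x ⊓ y).fst = x.fst ⊓ y.fst := rfl
@[simp] theorem snd_inf (x y : KExp A) : (x ⊓ y).snd = x.snd ⊔ y.snd := rfl
@[simp] theorem fst_mul (x y : KExp A) : (x * y).fst = x.fst * y.fst := rfl
@[simp] theorem snd_mul (x y : KExp A) :
    (x * y).snd = (x.fst ⇨ y.snd) ⊓ (y.fst ⇨ x.snd) := rfl
@[simp] theorem fst_himp (x y : KExp A) :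
    (x ⇨ y).fst = (x.fst ⇨ y.fst) ⊓ (y.snd ⇨ x.snd) := rfl
@[simp] theorem snd_himp (x y : KExp A) : (x ⇨ y).snd = x.fst * y.snd := rfl
@[simp] theorem fst_one : (1 : KExp A).fst = 1 := rfl
@[simp] theorem snd_one : (1 : KExp A).snd = 1 := rfl

theorem isHom_map {f : A → B} (hf : IsHom f) : IsHom (map f) where
  map_sup x y := KExp.ext (hf.map_sup _ _) (hf.map_inf _ _)
  map_inf x y := KExp.ext (hf.map_inf _ _) (hf.map_sup _ _)
  map_mul x y := KExp.ext (hf.map_mul _ _) (by simp [map, hf.map_inf, hf.map_himp])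
  map_himp x y := KExp.ext (by simp [map, hf.map_inf, hf.map_himp]) (hf.map_mul _ _)
  map_one := KExp.ext hf.map_one hf.map_one

/-- `a ↦ (a, 1)` is an isomorphism of an integral `A` onto the negative cone of `K(A)`. -/
def toNegCone (a : A) : NegCone (KExp A) := ⟨⟨a, 1⟩, Integral.le_one a, le_rfl⟩

theorem isHom_toNegCone : IsHom (toNegCone : A → NegCone (KExp A)) where
  map_sup _ _ := NegCone.ext (KExp.ext rfl (inf_idem (1 : A)).symm)
  map_inf _ _ := NegCone.ext (KExp.ext rfl (sup_idem (1 : A)).symm)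
  map_mul _ _ := NegCone.ext (KExp.ext rfl (by simp [toNegCone, himp_one]))
  map_himp x y := NegCone.ext (KExp.ext
    (by simp [toNegCone, himp_one, Integral.le_one]) (by simp [toNegCone, Integral.le_one]))
  map_one := rfl

theorem toNegCone_bijective : Function.Bijective (toNegCone : A → NegCone (KExp A)) := by
  refine ⟨fun x y h => congrArg (fun z => z.val.fst) h, fun y => ⟨y.val.fst, ?_⟩⟩
  exact NegCone.ext (KExp.ext rfl (le_antisymm y.le_one.2 (Integral.le_one _)))

/-- The K-expansion of an integral commutative residuated lattice is a K-lattice. -/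
theorem isKLattice : IsKLattice (KExp A) := by
  have h1 (a : A) : a ≤ 1 := Integral.le_one a
  constructor
  · intro b
    ext <;> simp [one_himp, himp_one, h1]
  · rintro x y z (rfl | rfl | rfl) <;> ext <;> simp [h1]
  · rintro x y z (rfl | rfl | rfl) <;> ext <;> simp [h1]
  · intro x y
    ext <;> simp [h1, himp_one]
  · intro x y
    ext <;> simp [h1, himp_one, one_himp, neg, mul_comm]

end KExp

/-! ### K-lattices with cancellative negative cone -/

namespace IsKLattice
variable {A : Type u} [CRL A]

/-- The map `a ↦ (a ⊓ 1, ¬a ⊓ 1)`. -/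
def toKExp (a : A) : KExp (NegCone A) :=
  ⟨⟨a ⊓ 1, inf_le_right⟩, ⟨neg a ⊓ 1, inf_le_right⟩⟩

theorem neg_neg (h : IsKLattice A) (a : A) : neg (neg a) = a := h.one_involutive a

theorem neg_sup (a b : A) : neg (a ⊔ b) = neg a ⊓ neg b := sup_himp a b 1

theorem neg_inf (h : IsKLattice A) (a b : A) : neg (a ⊓ b) = neg a ⊔ neg b := by
  rw [← h.neg_neg (neg a ⊔ neg b), neg_sup, h.neg_neg, h.neg_neg]

theorem neg_mul (a b : A) : neg (a * b) = a ⇨ neg b := mul_himp a b 1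

theorem neg_himp (h : IsKLattice A) (a b : A) : neg (a ⇨ b) = a * neg b := by
  rw [← h.neg_neg (a * neg b), neg_mul, h.neg_neg]

theorem neg_one : neg (1 : A) = 1 := one_himp 1

theorem sup_inf_one (h : IsKLattice A) (a b : A) : (a ⊔ b) ⊓ 1 = (a ⊓ 1) ⊔ (b ⊓ 1) := by
  rw [inf_comm, h.one_distrib_inf 1 a b (Or.inl rfl), inf_comm, inf_comm 1 b]

/-- This is (K2) met with `1`: both antecedents are below `1`, so truncating the consequents at `1`
changes nothing. -/
theorem himp_inf_one (h : IsKLattice A) (a b : A) :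
    (a ⇨ b) ⊓ 1 = (((a ⊓ 1) ⇨ (b ⊓ 1)) ⊓ 1) ⊓ (((neg b ⊓ 1) ⇨ (neg a ⊓ 1)) ⊓ 1) := by
  rw [himp_himp_inf_one inf_le_right, himp_himp_inf_one inf_le_right, ← inf_inf_distrib_right,
    h.k2]

/-- Negation exchanges the two coordinates, with `¬(xy) = x ⇨ ¬y` and `¬(x ⇨ y) = x * ¬y`. So (K1),
(K2) and distributivity at `1` settle both coordinates. -/
theorem isHom_toKExp (h : IsKLattice A) : IsHom (toKExp : A → KExp (NegCone A)) where
  map_sup x y := KExp.ext (NegCone.ext (h.sup_inf_one x y))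
    (NegCone.ext (by simp [toKExp, neg_sup, inf_inf_distrib_right]))
  map_inf x y := KExp.ext (NegCone.ext (by simp [toKExp, inf_inf_distrib_right]))
    (NegCone.ext (by simp [toKExp, h.neg_inf, h.sup_inf_one]))
  map_mul x y := KExp.ext (NegCone.ext (h.k1 x y)) (NegCone.ext (by
    simp only [toKExp, neg_mul, h.himp_inf_one x (neg y), h.neg_neg, KExp.snd_mul,
      NegCone.val_inf, NegCone.val_himp]))
  map_himp x y := KExp.ext (NegCone.ext (h.himp_inf_one x y))
    (NegCone.ext (by simp [toKExp, h.neg_himp, h.k1]))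
  map_one := KExp.ext (NegCone.ext (inf_idem 1)) (NegCone.ext (by simp [toKExp, neg_one]))

/-- The order can be read off the first coordinate, because `x ≤ y` iff `(x ⇨ y) ⊓ 1 = 1`. -/
theorem toKExp_injective (h : IsKLattice A) : Function.Injective (toKExp : A → _) := by
  have key (x y : A) (hxy : toKExp x = toKExp y) : x ≤ y := by
    have h1 : toKExp (x ⇨ y) = toKExp (x ⇨ x) := by
      rw [h.isHom_toKExp.map_himp, h.isHom_toKExp.map_himp, hxy]
    have h2 : (x ⇨ y) ⊓ 1 = (x ⇨ x) ⊓ 1 := congrArg (fun z => z.fst.val) h1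
    rw [inf_eq_right.2 (one_le_himp_iff.2 le_rfl), inf_eq_right] at h2
    exact one_le_himp_iff.1 h2
  exact fun x y hxy => le_antisymm (key x y hxy) (key y x hxy.symm)

theorem toKExp_surjective (h : IsKLattice A) (hc : Cancellative (NegCone A)) :
    Function.Surjective (toKExp : A → _) := by
  rintro ⟨p, q⟩
  have hpq : (p.val ⇨ p.val * q.val) ⊓ 1 = q.val := by
    refine congrArg NegCone.val (hc p (p ⇨ p * q) q (le_antisymm (mul_himp_le _ _) ?_))
    exact mul_mono le_rfl (le_himp_iff_mul_le.2 (mul_comm p q).ge)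
  -- As `¬(pq) ≥ 1`, (K1) gives first coordinate `p`; the negation of this witness is `p ⇨ pq`,
  -- which cancellation truncates to `q`.
  refine ⟨p.val * neg (p.val * q.val), KExp.ext (NegCone.ext ?_) (NegCone.ext ?_)⟩
  · have h1 : 1 ≤ neg (p.val * q.val) := one_le_himp_iff.2 (p * q).le_one
    simp only [toKExp]
    rw [h.k1, inf_eq_left.2 p.le_one, inf_eq_right.2 h1, mul_one]
  · simp only [toKExp, neg_mul p.val (neg _), h.neg_neg, hpq]

theorem toKExp_bijective (h : IsKLattice A) (hc : Cancellative (NegCone A)) :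
    Function.Bijective (toKExp : A → _) :=
  ⟨h.toKExp_injective, h.toKExp_surjective hc⟩

end IsKLattice

/-! ### Finitely many positive elements of a linearly ordered abelian group -/

/-- The combination `(-w 0) • v + v 0 • w` vanishes at index `0`, so that index may be dropped from
the sum. -/
theorem sum_succ_eliminate {n : ℕ} {M : Type*} [AddCommGroup M] (x : Fin (n + 1) → M)
    (v w : Fin (n + 1) → ℤ) :
    ∑ i : Fin n, ((-w 0) • v + v 0 • w) i.succ • x i.succ
      = (-w 0) • (∑ i, v i • x i) + v 0 • ∑ i, w i • x i := by
  simp only [Fin.sum_univ_succ, smul_add, Finset.smul_sum, smul_smul, Pi.add_apply,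
    Pi.smul_apply, smul_eq_mul, add_smul, Finset.sum_add_distrib]
  rw [mul_comm (v 0) (w 0), neg_mul, neg_smul]
  abel

/-- Fourier-Motzkin elimination: finitely many strict linear inequalities with integer coefficients
that are solvable in some linearly ordered abelian group are solvable in `ℚ`. -/
theorem exists_rat_of_pos {G : Type*} [AddCommGroup G] [LinearOrder G] [IsOrderedAddMonoid G] :
    ∀ (n : ℕ) (g : Fin n → G) (S : Finset (Fin n → ℤ)), (∀ v ∈ S, 0 < ∑ i, v i • g i) →
      ∃ x : Fin n → ℚ, ∀ v ∈ S, 0 < ∑ i, v i • x i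
  | 0, _, S, h => ⟨0, fun v hv => absurd (h v hv) (by simp)⟩
  | n + 1, g, S, h => by
    classical
    -- `Z` holds the inequalities free of the variable `0`; `P` eliminates it from each pair in
    -- which it has coefficients of opposite signs.
    let Z : Finset (Fin n → ℤ) := (S.filter fun v => v 0 = 0).image fun v i => v i.succ
    let P : Finset (Fin n → ℤ) :=
      ((S.filter fun v => 0 < v 0) ×ˢ (S.filter fun v => v 0 < 0)).image
        fun p i => ((-p.2 0) • p.1 + p.1 0 • p.2) i.succ
    obtain ⟨x, hx⟩ := exists_rat_of_pos n (fun i => g i.succ) (Z ∪ P) (by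
      intro v hv
      rcases Finset.mem_union.1 hv with hv | hv
      · obtain ⟨w, hw, rfl⟩ := Finset.mem_image.1 hv
        obtain ⟨hw, h0⟩ := Finset.mem_filter.1 hw
        simpa [Fin.sum_univ_succ, h0] using h w hw
      · obtain ⟨⟨v, w⟩, hvw, rfl⟩ := Finset.mem_image.1 hv
        simp only [Finset.mem_product, Finset.mem_filter] at hvw
        rw [sum_succ_eliminate g v w]
        exact add_pos (zsmul_pos (h v hvw.1.1) (by omega)) (zsmul_pos (h w hvw.2.1) hvw.1.2))
    let r (v : Fin (n + 1) → ℤ) : ℚ := ∑ i : Fin n, v i.succ • x i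
    -- The value `t` of the variable `0` must lie above the lower bounds (positive coefficient) and
    -- below the upper bounds (negative coefficient). The inequalities in `P` say that each lower
    -- bound is less than each upper bound.
    obtain ⟨t, htl, htr⟩ := Order.exists_between_finsets
      ((S.filter fun v => 0 < v 0).image fun v => -r v / v 0)
      ((S.filter fun v => v 0 < 0).image fun v => -r v / v 0) (by
        intro a ha b hb
        obtain ⟨v, hv, rfl⟩ := Finset.mem_image.1 ha
        obtain ⟨w, hw, rfl⟩ := Finset.mem_image.1 hb
        have hP := hx _ (Finset.mem_union_right _
          (Finset.mem_image_of_mem _ (Finset.mk_mem_product hv hw)))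
        -- The value `0` at index `0` reduces the two full sums to `r v` and `r w`.
        have e := sum_succ_eliminate (Fin.cons 0 x : Fin (n + 1) → ℚ) v w
        simp only [Fin.cons_succ, Fin.sum_univ_succ, Fin.cons_zero, smul_zero, zero_add] at e
        simp only at hP
        rw [e] at hP
        change 0 < (-w 0) • r v + v 0 • r w at hP
        have hv0 : (0 : ℚ) < v 0 := by exact_mod_cast (Finset.mem_filter.1 hv).2
        have hw0 : (w 0 : ℚ) < 0 := by exact_mod_cast (Finset.mem_filter.1 hw).2
        simp only [zsmul_eq_mul] at hP
        push_cast at hP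
        rw [div_lt_iff₀ hv0, div_mul_eq_mul_div, lt_div_iff_of_neg hw0]
        linarith)
    refine ⟨Fin.cons t x, fun v hv => ?_⟩
    have e : ∑ i, v i • (Fin.cons t x : Fin (n + 1) → ℚ) i = v 0 * t + r v := by
      simp [Fin.sum_univ_succ, r]
    rw [e]
    rcases lt_trichotomy (v 0) 0 with h0 | h0 | h0
    · have := htr _ (Finset.mem_image_of_mem _ (Finset.mem_filter.2 ⟨hv, h0⟩))
      rw [lt_div_iff_of_neg (by exact_mod_cast h0)] at this
      linarith
    · have := hx _ (Finset.mem_union_left _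
        (Finset.mem_image_of_mem _ (Finset.mem_filter.2 ⟨hv, h0⟩)))
      simpa [h0, r] using this
    · have := htl _ (Finset.mem_image_of_mem _ (Finset.mem_filter.2 ⟨hv, h0⟩))
      rw [div_lt_iff₀ (by exact_mod_cast h0)] at this
      linarith

/-- The subgroup generated by a finite set of elements of a linearly ordered abelian group has a
homomorphism to `ℤ` that is strictly increasing on the set. -/
theorem exists_strictMonoOn_closure {G : Type*} [AddCommGroup G] [LinearOrder G]
    [IsOrderedAddMonoid G] (T : Finset G) :
    ∃ f : AddSubgroup.closure (T : Set G) →+ ℤ,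
      ∀ s t : AddSubgroup.closure (T : Set G), (s : G) ∈ T → (t : G) ∈ T → s < t → f s < f t := by
  classical
  have : AddGroup.FG (AddSubgroup.closure (T : Set G)) := AddGroup.closure_finset_fg T
  have : Module.Finite ℤ (AddSubgroup.closure (T : Set G)) := Module.Finite.iff_addGroup_fg.2 this
  -- A finitely generated subgroup of an ordered group is torsion-free, hence free.
  let b := Module.finBasis ℤ (AddSubgroup.closure (T : Set G))
  let T' : Finset (AddSubgroup.closure (T : Set G)) :=
    T.attach.image fun t : {x // x ∈ T} => ⟨t.1, AddSubgroup.subset_closure t.2⟩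
  have hT' (s : AddSubgroup.closure (T : Set G)) (hs : (s : G) ∈ T) : s ∈ T' :=
    Finset.mem_image.2 ⟨⟨s, hs⟩, Finset.mem_attach _ _, rfl⟩
  obtain ⟨x, hx⟩ := exists_rat_of_pos _ b
    (((T' ×ˢ T').filter fun p => p.1 < p.2).image fun p i => b.repr (p.2 - p.1) i) (by
      intro v hv
      obtain ⟨p, hp, rfl⟩ := Finset.mem_image.1 hv
      rw [b.sum_repr]
      exact sub_pos.2 (Finset.mem_filter.1 hp).2)
  obtain ⟨d, hd⟩ := IsLocalization.exist_integer_multiples_of_finite (nonZeroDivisors ℤ) x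
  choose y hy using hd
  have hd0 : (d : ℤ) ≠ 0 := nonZeroDivisors.ne_zero d.2
  -- `y` is already the integral vector `d • x`. The second factor `d` makes the total scaling `d *
  -- d`, positive whatever the sign of `d`.
  let φ : AddSubgroup.closure (T : Set G) →ₗ[ℤ] ℤ := b.constr ℤ fun i => d * y i
  refine ⟨φ.toAddMonoidHom, fun s t hs ht hst => ?_⟩
  have h1 := hx _ (Finset.mem_image_of_mem _
    (Finset.mem_filter.2 ⟨Finset.mk_mem_product (hT' s hs) (hT' t ht), hst⟩))
  have h2 : ((φ (t - s) : ℤ) : ℚ) = (d : ℤ) * (d : ℤ) * ∑ i, b.repr (t - s) i • x i := by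
    simp only [φ, Module.Basis.constr_apply_fintype, Finset.mul_sum, Module.Basis.equivFun_apply]
    push_cast
    refine Finset.sum_congr rfl fun i _ => ?_
    have := hy i
    simp only [algebraMap_int_eq, eq_intCast, zsmul_eq_mul] at this
    simp only [smul_eq_mul, zsmul_eq_mul]
    push_cast
    rw [this]
    ring
  have h3 : (0 : ℚ) < (φ (t - s) : ℤ) := by
    rw [h2]
    have : ((d : ℤ) : ℚ) ≠ 0 := by exact_mod_cast hd0
    exact mul_pos (mul_self_pos.2 this) h1
  have h4 : 0 < φ (t - s) := by exact_mod_cast h3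
  rw [map_sub, sub_pos] at h4
  exact h4

/-! ### Cancellative hoops -/

namespace IsCancHoop
variable {A : Type u} [CRL A] (h : IsCancHoop A)
include h

theorem le_one (a : A) : a ≤ 1 := h.integral.le_one a

theorem himp_eq_one_iff {a b : A} : a ⇨ b = 1 ↔ a ≤ b := by
  rw [← one_le_himp_iff]
  exact ⟨ge_of_eq, le_antisymm (h.le_one _)⟩

theorem inf_eq (a b : A) : a ⊓ b = a * (a ⇨ b) := by
  refine le_antisymm ?_ (le_inf (mul_le_left_of_le_one (h.le_one _)) (mul_himp_le a b))
  have h1 : a ⊓ b = (a ⊓ b) * ((a ⊓ b) ⇨ a) := by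
    rw [h.himp_eq_one_iff.2 inf_le_left, mul_one]
  rw [h1, h.divisible]
  exact mul_mono le_rfl (himp_mono_right a inf_le_right)

theorem mul_himp_of_le {a b : A} (hab : b ≤ a) : a * (a ⇨ b) = b := by
  rw [← h.inf_eq, inf_eq_right.2 hab]

theorem himp_mul_cancel (a b : A) : a ⇨ (a * b) = b :=
  h.cancellative a _ _ (h.mul_himp_of_le (mul_le_left_of_le_one (h.le_one b)))

/-- Write `a ⇨ b = d * p` and `b ⇨ a = d * q` with `d` the join. Cancelling `d` in divisibility
gives `a * p = b * q ≤ b`, so `p ≤ a ⇨ b = d * p ≤ p`, and cancelling `p` gives `d = 1`. -/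
theorem himp_sup_himp (a b : A) : (a ⇨ b) ⊔ (b ⇨ a) = 1 := by
  set d := (a ⇨ b) ⊔ (b ⇨ a) with hd
  have hp : d * (d ⇨ (a ⇨ b)) = a ⇨ b := h.mul_himp_of_le le_sup_left
  have hq : d * (d ⇨ (b ⇨ a)) = b ⇨ a := h.mul_himp_of_le le_sup_right
  have e : a * (d ⇨ (a ⇨ b)) = b * (d ⇨ (b ⇨ a)) := by
    apply h.cancellative d
    rw [mul_left_comm, hp, mul_left_comm, hq, h.divisible]
  have le : d ⇨ (a ⇨ b) ≤ a ⇨ b := by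
    rw [le_himp_iff_mul_le, mul_comm, e]
    exact mul_le_left_of_le_one (h.le_one _)
  refine h.cancellative (d ⇨ (a ⇨ b)) _ _ ?_
  rw [mul_comm, hp, mul_one]
  exact le_antisymm (le_himp_iff_mul_le.2 (mul_le_left_of_le_one (h.le_one _))) le

theorem sup_mul_himp_left (a b : A) : (a ⊔ b) * (b ⇨ a) = a := by
  have : (a ⊔ b) ⇨ a = b ⇨ a := by
    rw [sup_himp, h.himp_eq_one_iff.2 le_rfl, inf_eq_right.2 (h.le_one _)]
  rw [← this, h.mul_himp_of_le le_sup_left]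

theorem sup_mul_himp_right (a b : A) : (a ⊔ b) * (a ⇨ b) = b := by
  rw [sup_comm, h.sup_mul_himp_left]

/-- `C_ω` embeds in every nontrivial cancellative hoop. -/
theorem exists_embedding_cOmega [Nontrivial A] :
    ∃ f : COmega.{u} → A, IsHom f ∧ Function.Injective f := by
  obtain ⟨a, ha⟩ := exists_ne (1 : A)
  have anti {r s : ℕ} (hrs : r ≤ s) : a ^ s ≤ a ^ r := by
    rw [← Nat.add_sub_cancel' hrs, pow_add]
    exact mul_le_left_of_le_one (h.le_one _)
  refine ⟨fun n => a ^ n.exp, ⟨fun x y => ?_, fun x y => ?_, fun x y => pow_add a _ _,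
    fun x y => ?_, pow_zero a⟩, ?_⟩
  · change a ^ min x.exp y.exp = _
    rcases le_total x.exp y.exp with hxy | hxy
    · rw [min_eq_left hxy, sup_eq_left.2 (anti hxy)]
    · rw [min_eq_right hxy, sup_eq_right.2 (anti hxy)]
  · change a ^ max x.exp y.exp = _
    rcases le_total x.exp y.exp with hxy | hxy
    · rw [max_eq_right hxy, inf_eq_right.2 (anti hxy)]
    · rw [max_eq_left hxy, inf_eq_left.2 (anti hxy)]
  · change a ^ (y.exp - x.exp) = _
    rcases le_total x.exp y.exp with hxy | hxy
    · nth_rewrite 2 [← Nat.add_sub_cancel' hxy]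
      rw [pow_add, h.himp_mul_cancel]
    · rw [Nat.sub_eq_zero_of_le hxy, pow_zero, h.himp_eq_one_iff.2 (anti hxy)]
  · have key {r s : ℕ} (hrs : r < s) : a ^ r ≠ a ^ s := fun e => by
      have h1 : a ^ (s - r) = 1 := by
        apply h.cancellative (a ^ r)
        rw [← pow_add, Nat.add_sub_cancel' hrs.le, mul_one, e]
      have h2 : a ^ (s - r) ≤ a ^ 1 := anti (by omega)
      rw [h1, pow_one] at h2
      exact ha (le_antisymm (h.le_one a) h2)
    rintro ⟨r⟩ ⟨s⟩ (e : a ^ r = a ^ s)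
    rcases lt_trichotomy r s with hrs | rfl | hrs
    · exact absurd e (key hrs)
    · rfl
    · exact absurd e.symm (key hrs)

/-- Finite cancellative hoops are trivial. -/
theorem subsingleton [Finite A] : Subsingleton A := by
  by_contra hn
  have := not_subsingleton_iff_nontrivial.1 hn
  obtain ⟨f, -, hf⟩ := h.exists_embedding_cOmega
  have : Finite COmega.{u} := Finite.of_injective f hf
  have : Finite ℕ := Finite.of_injective (COmega.mk.{u}) fun _ _ e => congrArg COmega.exp e
  exact not_finite ℕ

end IsCancHoop

/-- These conditions are all equations, hence stable under images, subalgebras and products; `a ⇨ (a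
* b) = b` replaces the cancellation implication. -/
theorem isCancHoop_of_himp_mul {A : Type u} [CRL A] (h1 : ∀ a : A, a ⊔ 1 = 1)
    (hd : ∀ a b : A, a * (a ⇨ b) = b * (b ⇨ a)) (hc : ∀ a b : A, a ⇨ (a * b) = b) :
    IsCancHoop A where
  integral := ⟨fun a => sup_eq_right.1 (h1 a)⟩
  divisible := hd
  cancellative a b c e := by rw [← hc a b, e, hc]

theorem isCancHoop_cOmega : IsCancHoop COmega.{u} where
  integral := inferInstance
  divisible x y := COmega.ext (show x.exp + (y.exp - x.exp) = y.exp + (x.exp - y.exp) by omega)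
  cancellative x y z e := COmega.ext (by
    have : x.exp + y.exp = x.exp + z.exp := congrArg COmega.exp e
    omega)

theorem IsCancHoop.of_injective {A B : Type u} [CRL A] [CRL B] (hB : IsCancHoop B) {f : A → B}
    (hf : IsHom f) (hi : Function.Injective f) : IsCancHoop A := by
  refine isCancHoop_of_himp_mul (fun a => hi ?_) (fun a b => hi ?_) (fun a b => hi ?_)
  · rw [hf.map_sup, hf.map_one, sup_eq_right.2 (hB.le_one _)]
  · rw [hf.map_mul, hf.map_mul, hf.map_himp, hf.map_himp, hB.divisible]
  · rw [hf.map_himp, hf.map_mul, hB.himp_mul_cancel]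

/-- Cancellative hoops form a variety. -/
theorem isVariety_cancHoops : IsVariety CancHoops.{u} where
  image := by
    rintro A B (hA : IsCancHoop A.carrier) ⟨f, hf, hs⟩
    refine isCancHoop_of_himp_mul (fun a => ?_) (fun a b => ?_) (fun a b => ?_)
    · obtain ⟨a, rfl⟩ := hs a
      rw [← hf.map_one, ← hf.map_sup, sup_eq_right.2 (hA.le_one _)]
    · obtain ⟨a, rfl⟩ := hs a
      obtain ⟨b, rfl⟩ := hs b
      rw [← hf.map_himp, ← hf.map_himp, ← hf.map_mul, ← hf.map_mul, hA.divisible]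
    · obtain ⟨a, rfl⟩ := hs a
      obtain ⟨b, rfl⟩ := hs b
      rw [← hf.map_mul, ← hf.map_himp, hA.himp_mul_cancel]
  sub := by
    rintro A B (hB : IsCancHoop B.carrier) ⟨f, hf, hi⟩
    exact hB.of_injective hf hi
  prod := by
    intro ι A hA
    have hA (i : ι) : IsCancHoop (A i).carrier := hA i
    exact isCancHoop_of_himp_mul (fun a => funext fun i => sup_eq_right.2 ((hA i).le_one _))
      (fun a b => funext fun i => (hA i).divisible _ _)
      (fun a b => funext fun i => (hA i).himp_mul_cancel _ _)

/-! ### The variety of K-lattices -/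

theorem isVariety_KL : IsVariety KL.{u} where
  image := by
    rintro A B (hA : IsKLattice A.carrier) ⟨f, hf, hs⟩
    -- The distributive laws are conditional on an argument being `1`, so `1` must be lifted to `1`.
    have lift {x : B.carrier} : ∃ a, f a = x ∧ (x = 1 → a = 1) := by
      by_cases hx : x = 1
      · exact ⟨1, hf.map_one.trans hx.symm, fun _ => rfl⟩
      · obtain ⟨a, ha⟩ := hs x
        exact ⟨a, ha, fun h => absurd h hx⟩
    constructor
    · intro b
      obtain ⟨b, rfl⟩ := hs b
      rw [← hf.map_one, ← hf.map_himp, ← hf.map_himp, hA.one_involutive]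
    · intro x y z hxyz
      obtain ⟨x, rfl, hx⟩ := @lift x
      obtain ⟨y, rfl, hy⟩ := @lift y
      obtain ⟨z, rfl, hz⟩ := @lift z
      simp only [← hf.map_sup, ← hf.map_inf, hA.one_distrib_inf x y z (by tauto)]
    · intro x y z hxyz
      obtain ⟨x, rfl, hx⟩ := @lift x
      obtain ⟨y, rfl, hy⟩ := @lift y
      obtain ⟨z, rfl, hz⟩ := @lift z
      simp only [← hf.map_sup, ← hf.map_inf, hA.one_distrib_sup x y z (by tauto)]
    · intro x y
      obtain ⟨x, rfl⟩ := hs x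
      obtain ⟨y, rfl⟩ := hs y
      simp only [← hf.map_one, ← hf.map_mul, ← hf.map_inf, hA.k1]
    · intro x y
      obtain ⟨x, rfl⟩ := hs x
      obtain ⟨y, rfl⟩ := hs y
      simp only [← hf.map_neg, ← hf.map_one, ← hf.map_himp, ← hf.map_inf, hA.k2]
  sub := by
    rintro A B (hB : IsKLattice B.carrier) ⟨f, hf, hi⟩
    have one {x : A.carrier} (hx : x = 1) : f x = 1 := by rw [hx, hf.map_one]
    constructor
    · intro b
      apply hi
      rw [hf.map_himp, hf.map_himp, hf.map_one, hB.one_involutive]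
    · intro x y z hxyz
      apply hi
      simp only [hf.map_sup, hf.map_inf]
      exact hB.one_distrib_inf _ _ _ (hxyz.imp one (Or.imp one one))
    · intro x y z hxyz
      apply hi
      simp only [hf.map_sup, hf.map_inf]
      exact hB.one_distrib_sup _ _ _ (hxyz.imp one (Or.imp one one))
    · intro x y
      apply hi
      simp only [hf.map_one, hf.map_mul, hf.map_inf, hB.k1]
    · intro x y
      apply hi
      simp only [hf.map_neg, hf.map_one, hf.map_himp, hf.map_inf, hB.k2]
  prod := by
    intro ι A hA
    have hA (i : ι) : IsKLattice (A i).carrier := hA i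
    have one {x : ∀ i, (A i).carrier} (i : ι) (hx : x = 1) : x i = 1 := congrFun hx i
    exact ⟨fun b => funext fun i => (hA i).one_involutive _,
      fun x y z h => funext fun i =>
        (hA i).one_distrib_inf _ _ _ (h.imp (one i) (Or.imp (one i) (one i))),
      fun x y z h => funext fun i =>
        (hA i).one_distrib_sup _ _ _ (h.imp (one i) (Or.imp (one i) (one i))),
      fun x y => funext fun i => (hA i).k1 _ _, fun x y => funext fun i => (hA i).k2 _ _⟩

/-! ### The class `K(C)` -/

/-- An embedding of `A` in `K(L)` restricts to one of `A⁻` in `K(L)⁻ ≅ L`; conversely `A` embeds in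
`K(A⁻)`. The witness `L` is thereby replaced by conditions on `A` alone. -/
theorem mem_kClass_cancHoops_iff {A : CRLat.{u}} :
    A ∈ KClass CancHoops ↔ IsKLattice A.carrier ∧ IsCancHoop (NegCone A.carrier) := by
  constructor
  · rintro ⟨hA, L, hL, _, f, hf, hi⟩
    obtain ⟨g, hg, hgb⟩ := (KExp.isHom_toNegCone (A := L.carrier)).exists_inverse
      KExp.toNegCone_bijective
    exact ⟨hA, IsCancHoop.of_injective hL (hg.comp (NegCone.isHom_map hf))
      (hgb.injective.comp (NegCone.map_injective hf hi))⟩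
  · rintro ⟨hA, hC⟩
    exact ⟨hA, ⟨NegCone A.carrier⟩, hC, inferInstance, _, hA.isHom_toKExp, hA.toKExp_injective⟩

theorem kExp_mem_kClass {L : Type u} [CRL L] [Integral L] (hL : IsCancHoop L) :
    (⟨KExp L⟩ : CRLat.{u}) ∈ KClass CancHoops :=
  ⟨KExp.isKLattice, ⟨L⟩, hL, inferInstance, id, isHom_id _, Function.injective_id⟩

theorem isVariety_kClass_cancHoops : IsVariety (KClass CancHoops.{u}) where
  image := by
    rintro A B hA ⟨f, hf, hs⟩
    rw [mem_kClass_cancHoops_iff] at hA ⊢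
    exact ⟨isVariety_KL.image A B hA.1 ⟨f, hf, hs⟩,
      isVariety_cancHoops.image ⟨NegCone A.carrier⟩ ⟨NegCone B.carrier⟩ hA.2
        ⟨_, NegCone.isHom_map hf, NegCone.map_surjective hf hs⟩⟩
  sub := by
    rintro A B hB ⟨f, hf, hi⟩
    rw [mem_kClass_cancHoops_iff] at hB ⊢
    exact ⟨isVariety_KL.sub A B hB.1 ⟨f, hf, hi⟩,
      hB.2.of_injective (NegCone.isHom_map hf) (NegCone.map_injective hf hi)⟩
  prod := by
    intro ι A hA
    simp only [mem_kClass_cancHoops_iff] at hA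
    refine mem_kClass_cancHoops_iff.2 ⟨isVariety_KL.prod ι A fun i => (hA i).1, ?_⟩
    have hev (i : ι) := isHom_eval (fun i => (A i).carrier) i
    refine IsCancHoop.of_injective
      (isVariety_cancHoops.prod ι (fun i => ⟨NegCone (A i).carrier⟩) fun i => (hA i).2)
      (f := fun x i => NegCone.map _ (hev i) x) ?_ fun x y hxy => NegCone.ext ?_
    · exact ⟨fun x y => funext fun i => (NegCone.isHom_map (hev i)).map_sup x y,
        fun x y => funext fun i => (NegCone.isHom_map (hev i)).map_inf x y,
        fun x y => funext fun i => (NegCone.isHom_map (hev i)).map_mul x y,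
        fun x y => funext fun i => (NegCone.isHom_map (hev i)).map_himp x y,
        funext fun i => (NegCone.isHom_map (hev i)).map_one⟩
    · exact funext fun i => congrArg NegCone.val (congrFun hxy i)

theorem negClass_kClass_cancHoops : NegClass (KClass CancHoops.{u}) = CancHoops := by
  apply Set.Subset.antisymm
  · refine fun B hB => hB _ isVariety_cancHoops ?_
    rintro _ ⟨A, hA, rfl⟩
    exact (mem_kClass_cancHoops_iff.1 hA).2
  · intro L hL W hW hsub
    have : Integral L.carrier := IsCancHoop.integral hL
    exact hW.sub L _ (hsub ⟨_, kExp_mem_kClass hL, rfl⟩)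
      ⟨_, KExp.isHom_toNegCone, KExp.toNegCone_bijective.injective⟩

theorem isKalman_kClass_cancHoops : IsKalman (KClass CancHoops.{u}) := by
  rw [IsKalman, negClass_kClass_cancHoops]

/-- A variety that contains a nontrivial member of `K(C)` contains `K(C_ω)`. -/
theorem kExp_cOmega_mem {W : Set CRLat.{u}} (hW : IsVariety W) {A : CRLat.{u}} (hA : A ∈ W)
    (hK : A ∈ KClass CancHoops) (hn : Nontrivial A.carrier) :
    (⟨KExp COmega.{u}⟩ : CRLat.{u}) ∈ W := by
  obtain ⟨hA1, hC⟩ := mem_kClass_cancHoops_iff.1 hK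
  have : Nontrivial (NegCone A.carrier) := by
    rw [← not_subsingleton_iff_nontrivial] at hn ⊢
    refine fun hs => hn ⟨fun x y => hA1.toKExp_injective ?_⟩
    exact KExp.ext (Subsingleton.elim _ _) (Subsingleton.elim _ _)
  obtain ⟨f, hf, hi⟩ := hC.exists_embedding_cOmega
  obtain ⟨g, hg, hgb⟩ :=
    hA1.isHom_toKExp.exists_inverse (hA1.toKExp_bijective hC.cancellative)
  -- The inverse isomorphism `K(A⁻) → A` carries the copy of `K(C_ω)` back into `A`.
  exact hW.sub _ A hA ⟨_, hg.comp (KExp.isHom_map hf),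
    hgb.injective.comp (KExp.map_injective hi)⟩

theorem var_subset {S W : Set CRLat.{u}} (hW : IsVariety W) (h : S ⊆ W) : Var S ⊆ W :=
  fun _ hA => hA W hW h

theorem subset_var (S : Set CRLat.{u}) : S ⊆ Var S := fun _ hA _ _ h => h hA

theorem not_subsingleton_kExp_cOmega : ¬ Subsingleton (KExp COmega.{u}) := fun h => by
  have := congrArg (fun x : KExp COmega.{u} => x.fst.exp) (h.elim ⟨⟨0⟩, ⟨0⟩⟩ ⟨⟨1⟩, ⟨0⟩⟩)
  simp at this

/-- A finite member has a finite, hence trivial, negative cone and is itself trivial, so finite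
members generate only the trivial variety. -/
theorem not_finitelyGenerated_kClass_cancHoops :
    ¬ FinitelyGenerated (KClass CancHoops.{u}) := by
  rintro ⟨S, -, hS, hV⟩
  have hT : S ⊆ Triv := fun A hA => by
    have hK : A ∈ KClass CancHoops := hV ▸ subset_var S hA
    obtain ⟨hA1, hC⟩ := mem_kClass_cancHoops_iff.1 hK
    have := hS A hA
    have : Finite (NegCone A.carrier) :=
      Finite.of_injective NegCone.val fun _ _ h => NegCone.ext h
    have := hC.subsingleton
    exact ⟨fun x y => hA1.toKExp_injective
      (KExp.ext (Subsingleton.elim _ _) (Subsingleton.elim _ _))⟩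
  have h1 : (⟨KExp COmega.{u}⟩ : CRLat.{u}) ∈ Var S := hV ▸ kExp_mem_kClass isCancHoop_cOmega
  exact not_subsingleton_kExp_cOmega (var_subset isVariety_triv hT h1)

/-! ### Algebras separated by local homomorphisms -/

/-- Preservation of all operations applied to elements of the set `T`. -/
structure IsHomOn {A B : Type u} [CRL A] [CRL B] (T : Set A) (f : A → B) : Prop where
  map_sup : ∀ x ∈ T, ∀ y ∈ T, f (x ⊔ y) = f x ⊔ f y
  map_inf : ∀ x ∈ T, ∀ y ∈ T, f (x ⊓ y) = f x ⊓ f y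
  map_mul : ∀ x ∈ T, ∀ y ∈ T, f (x * y) = f x * f y
  map_himp : ∀ x ∈ T, ∀ y ∈ T, f (x ⇨ y) = f x ⇨ f y
  map_one : f 1 = 1

/-- Distinct elements of `A` are separated by maps to `B` that are homomorphisms on any given
finite subset of `A`. -/
def LocallySeparated (A B : Type u) [CRL A] [CRL B] : Prop :=
  ∀ (T : Finset A) (x y : A), x ≠ y → ∃ f : A → B, IsHomOn (T : Set A) f ∧ f x ≠ f y

/-- Subalgebras. -/
@[reducible] def subCRL {A : Type u} [CRL A] (s : Set A)
    (hsup : ∀ x ∈ s, ∀ y ∈ s, x ⊔ y ∈ s) (hinf : ∀ x ∈ s, ∀ y ∈ s, x ⊓ y ∈ s)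
    (hmul : ∀ x ∈ s, ∀ y ∈ s, x * y ∈ s) (himp : ∀ x ∈ s, ∀ y ∈ s, x ⇨ y ∈ s)
    (hone : (1 : A) ∈ s) : CRL s where
  sup a b := ⟨a ⊔ b, hsup _ a.2 _ b.2⟩
  le_sup_left a b := show a.1 ≤ a.1 ⊔ b.1 from le_sup_left
  le_sup_right a b := show b.1 ≤ a.1 ⊔ b.1 from le_sup_right
  sup_le a b c h k := show a.1 ⊔ b.1 ≤ c.1 from sup_le h k
  inf a b := ⟨a ⊓ b, hinf _ a.2 _ b.2⟩
  inf_le_left a b := show a.1 ⊓ b.1 ≤ a.1 from inf_le_left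
  inf_le_right a b := show a.1 ⊓ b.1 ≤ b.1 from inf_le_right
  le_inf a b c h k := show a.1 ≤ b.1 ⊓ c.1 from le_inf h k
  mul a b := ⟨a * b, hmul _ a.2 _ b.2⟩
  mul_assoc a b c := Subtype.ext (mul_assoc a.1 b.1 c.1)
  mul_comm a b := Subtype.ext (mul_comm a.1 b.1)
  one := ⟨1, hone⟩
  one_mul a := Subtype.ext (one_mul a.1)
  mul_one a := Subtype.ext (mul_one a.1)
  himp a b := ⟨a.1 ⇨ b.1, himp _ a.2 _ b.2⟩
  mul_le_iff a b c := CRL.mul_le_iff a.1 b.1 c.1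

open Filter in
/-- If `A` is locally separated by maps to `B`, then `A` is a homomorphic image of a subalgebra of
a power of `B`. -/
theorem LocallySeparated.mem_of_isVariety {A B : Type u} [CRL A] [CRL B]
    (h : LocallySeparated A B) {W : Set CRLat.{u}} (hW : IsVariety W)
    (hB : (⟨B⟩ : CRLat.{u}) ∈ W) : (⟨A⟩ : CRLat.{u}) ∈ W := by
  classical
  let J := {p : A × A // p.1 ≠ p.2}
  choose f hf hne using fun i : Finset A × J => h i.1 i.2.1.1 i.2.1.2 i.2.2
  -- `R g a` says that, for each pair `j`, `g` represents `a` at all sufficiently large finite sets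
  -- `T`. The representing `g` form a subalgebra of the power, and `R` is the graph of a
  -- homomorphism from it onto `A`.
  let R (g : Finset A × J → B) (a : A) : Prop := ∀ j, ∀ᶠ T in atTop, g (T, j) = f (T, j) a
  have lift {op : A → A → A} {op' : B → B → B}
      (hop : ∀ i, ∀ x ∈ i.1, ∀ y ∈ i.1, f i (op x y) = op' (f i x) (f i y))
      {g g' : Finset A × J → B} {a a' : A} (hg : R g a) (hg' : R g' a') :
      R (fun i => op' (g i) (g' i)) (op a a') := fun j => by
    filter_upwards [hg j, hg' j, eventually_ge_atTop {a, a'}] with T h1 h2 h3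
    rw [h1, h2, hop (T, j) a (h3 (by simp)) a' (h3 (by simp))]
  have rsup {g g' a a'} (hg : R g a) (hg' : R g' a') : R (g ⊔ g') (a ⊔ a') :=
    lift (fun i => (hf i).map_sup) hg hg'
  have rinf {g g' a a'} (hg : R g a) (hg' : R g' a') : R (g ⊓ g') (a ⊓ a') :=
    lift (fun i => (hf i).map_inf) hg hg'
  have rmul {g g' a a'} (hg : R g a) (hg' : R g' a') : R (g * g') (a * a') :=
    lift (fun i => (hf i).map_mul) hg hg'
  have rhimp {g g' a a'} (hg : R g a) (hg' : R g' a') : R (g ⇨ g') (a ⇨ a') :=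
    lift (fun i => (hf i).map_himp) hg hg'
  have rone : R 1 1 := fun j => .of_forall fun T => (hf (T, j)).map_one.symm
  -- At index pair `(a, a')` every map separates `a` from `a'`, whatever `T` is, so one `g` cannot
  -- represent both.
  have unique {g a a'} (hg : R g a) (hg' : R g a') : a = a' := by
    by_contra hn
    obtain ⟨T, h1, h2⟩ := ((hg ⟨(a, a'), hn⟩).and (hg' ⟨(a, a'), hn⟩)).exists
    exact hne (T, ⟨(a, a'), hn⟩) (h1.symm.trans h2)
  let s : Set (Finset A × J → B) := {g | ∃ a, R g a}
  let _ : CRL s := subCRL s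
    (fun _ ⟨_, h1⟩ _ ⟨_, h2⟩ => ⟨_, rsup h1 h2⟩) (fun _ ⟨_, h1⟩ _ ⟨_, h2⟩ => ⟨_, rinf h1 h2⟩)
    (fun _ ⟨_, h1⟩ _ ⟨_, h2⟩ => ⟨_, rmul h1 h2⟩) (fun _ ⟨_, h1⟩ _ ⟨_, h2⟩ => ⟨_, rhimp h1 h2⟩)
    ⟨_, rone⟩
  have hs : (⟨s⟩ : CRLat.{u}) ∈ W :=
    hW.sub _ _ (hW.prod (Finset A × J) (fun _ => ⟨B⟩) fun _ => hB)
      ⟨Subtype.val, by constructor <;> intros <;> rfl, Subtype.val_injective⟩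
  choose φ hφ using fun g : s => g.2
  refine hW.image ⟨s⟩ _ hs ⟨φ, ⟨fun x y => ?_, fun x y => ?_, fun x y => ?_, fun x y => ?_, ?_⟩,
    fun a => ?_⟩
  · exact unique (hφ (x ⊔ y)) (rsup (hφ x) (hφ y))
  · exact unique (hφ (x ⊓ y)) (rinf (hφ x) (hφ y))
  · exact unique (hφ (x * y)) (rmul (hφ x) (hφ y))
  · exact unique (hφ (x ⇨ y)) (rhimp (hφ x) (hφ y))
  · exact unique (hφ 1) rone
  · have ha : R (fun i => f i a) a := fun j => .of_forall fun T => rfl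
    let g : s := ⟨fun i => f i a, a, ha⟩
    exact ⟨g, unique (hφ g) ha⟩

theorem LocallySeparated.kExp {A B : Type u} [CRL A] [Integral A] [CRL B] [Integral B]
    (h : LocallySeparated A B) : LocallySeparated (KExp A) (KExp B) := by
  classical
  intro T x y hxy
  let U : Finset A := T.image KExp.fst ∪ T.image KExp.snd
  -- Products and residuals in `K(A)` contain meets of residuals of coordinates, so the local
  -- homomorphism must respect meets of such residuals too.
  let V : Finset A := U ∪ Finset.image₂ (· ⇨ ·) U U
  have key (a b : A) (hab : a ≠ b) : ∃ f : A → B, IsHomOn (T : Set (KExp A)) (KExp.map f) ∧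
      f a ≠ f b := by
    obtain ⟨f, hf, hne⟩ := h V a b hab
    have hU (z : A) (hz : z ∈ U) : z ∈ (V : Set A) := Finset.mem_union_left _ hz
    have hU2 (z w : A) (hz : z ∈ U) (hw : w ∈ U) : z ⇨ w ∈ (V : Set A) :=
      Finset.mem_union_right _ (Finset.mem_image₂_of_mem hz hw)
    have h1 (z : KExp A) (hz : z ∈ (T : Set (KExp A))) : z.fst ∈ U :=
      Finset.mem_union_left _ (Finset.mem_image_of_mem _ hz)
    have h2 (z : KExp A) (hz : z ∈ (T : Set (KExp A))) : z.snd ∈ U :=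
      Finset.mem_union_right _ (Finset.mem_image_of_mem _ hz)
    refine ⟨f, ⟨fun z hz w hw => KExp.ext ?_ ?_, fun z hz w hw => KExp.ext ?_ ?_,
      fun z hz w hw => KExp.ext ?_ ?_, fun z hz w hw => KExp.ext ?_ ?_,
      KExp.ext hf.map_one hf.map_one⟩, hne⟩
    · exact hf.map_sup _ (hU _ (h1 z hz)) _ (hU _ (h1 w hw))
    · exact hf.map_inf _ (hU _ (h2 z hz)) _ (hU _ (h2 w hw))
    · exact hf.map_inf _ (hU _ (h1 z hz)) _ (hU _ (h1 w hw))
    · exact hf.map_sup _ (hU _ (h2 z hz)) _ (hU _ (h2 w hw))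
    · exact hf.map_mul _ (hU _ (h1 z hz)) _ (hU _ (h1 w hw))
    · simp only [KExp.map, KExp.snd_mul]
      rw [hf.map_inf _ (hU2 _ _ (h1 z hz) (h2 w hw)) _ (hU2 _ _ (h1 w hw) (h2 z hz)),
        hf.map_himp _ (hU _ (h1 z hz)) _ (hU _ (h2 w hw)),
        hf.map_himp _ (hU _ (h1 w hw)) _ (hU _ (h2 z hz))]
    · simp only [KExp.map, KExp.fst_himp]
      rw [hf.map_inf _ (hU2 _ _ (h1 z hz) (h1 w hw)) _ (hU2 _ _ (h2 w hw) (h2 z hz)),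
        hf.map_himp _ (hU _ (h1 z hz)) _ (hU _ (h1 w hw)),
        hf.map_himp _ (hU _ (h2 w hw)) _ (hU _ (h2 z hz))]
    · exact hf.map_mul _ (hU _ (h1 z hz)) _ (hU _ (h2 w hw))
  by_cases h1 : x.fst = y.fst
  · obtain ⟨f, hf, hne⟩ := key x.snd y.snd fun h2 => hxy (KExp.ext h1 h2)
    exact ⟨_, hf, fun e => hne (congrArg KExp.snd e)⟩
  · obtain ⟨f, hf, hne⟩ := key x.fst y.fst h1
    exact ⟨_, hf, fun e => hne (congrArg KExp.fst e)⟩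

/-! ### Prime filters of cancellative hoops -/

/-- Filters: upward closed submonoids. -/
structure IsFilter {A : Type u} [CRL A] (F : Set A) : Prop where
  one_mem : 1 ∈ F
  mul_mem : ∀ {x y}, x ∈ F → y ∈ F → x * y ∈ F
  mem_of_le : ∀ {x y}, x ∈ F → x ≤ y → y ∈ F

namespace IsFilter
variable {A : Type u} [CRL A] {F : Set A}

/-- The filter generated by a filter and an element. -/
theorem adjoin (hF : IsFilter F) (d : A) : IsFilter {z | ∃ u ∈ F, ∃ n : ℕ, u * d ^ n ≤ z} where
  one_mem := ⟨1, hF.one_mem, 0, by simp⟩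
  mul_mem := by
    rintro x y ⟨u, hu, m, hm⟩ ⟨v, hv, n, hn⟩
    refine ⟨u * v, hF.mul_mem hu hv, m + n, ?_⟩
    rw [pow_add, mul_mul_mul_comm]
    exact mul_mono hm hn
  mem_of_le := by
    rintro x y ⟨u, hu, m, hm⟩ hxy
    exact ⟨u, hu, m, hm.trans hxy⟩

end IsFilter

namespace IsCancHoop
variable {A : Type u} [CRL A] (h : IsCancHoop A)
include h

/-- Expanding `(p ⊔ q) * (p ⊔ r)`, every term except `q * r` lies below `p`. -/
theorem sup_mul_eq_one {p q r : A} (hq : p ⊔ q = 1) (hr : p ⊔ r = 1) : p ⊔ q * r = 1 := by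
  refine le_antisymm (h.le_one _) ?_
  calc (1 : A) = (p ⊔ q) * (p ⊔ r) := by rw [hq, hr, mul_one]
    _ = (p ⊔ q) * p ⊔ (p * r ⊔ q * r) := by rw [mul_sup, mul_comm _ r, mul_sup, mul_comm r,
        mul_comm r]
    _ ≤ p ⊔ q * r := sup_le (le_sup_of_le_left (by
          rw [mul_comm]; exact mul_le_left_of_le_one (h.le_one _)))
        (sup_le_sup_right (mul_le_left_of_le_one (h.le_one _)) _)

theorem sup_pow_eq_one {p q : A} (hpq : p ⊔ q = 1) (n : ℕ) : p ⊔ q ^ n = 1 := by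
  induction n with
  | zero => rw [pow_zero, sup_eq_right.2 (h.le_one p)]
  | succ n ih => rw [pow_succ]; exact h.sup_mul_eq_one ih hpq

theorem pow_sup_pow_eq_one {p q : A} (hpq : p ⊔ q = 1) (m n : ℕ) : p ^ m ⊔ q ^ n = 1 := by
  refine h.sup_pow_eq_one ?_ n
  rw [sup_comm] at hpq ⊢
  exact h.sup_pow_eq_one hpq m

/-- An element other than `1` is omitted by a prime filter. -/
theorem exists_prime_filter {a : A} (ha : a ≠ 1) :
    ∃ F : Set A, IsFilter F ∧ a ∉ F ∧ ∀ x y, x ⇨ y ∈ F ∨ y ⇨ x ∈ F := by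
  obtain ⟨F, -, hF⟩ := zorn_subset_nonempty {F : Set A | IsFilter F ∧ a ∉ F} (by
    intro c hc hchain hne
    refine ⟨⋃₀ c, ⟨⟨?_, ?_, ?_⟩, ?_⟩, fun s hs => Set.subset_sUnion_of_mem hs⟩
    · obtain ⟨s, hs⟩ := hne
      exact ⟨s, hs, (hc hs).1.one_mem⟩
    · rintro x y ⟨s, hs, hx⟩ ⟨t, ht, hy⟩
      rcases hchain.total hs ht with hst | hst
      · exact ⟨t, ht, (hc ht).1.mul_mem (hst hx) hy⟩
      · exact ⟨s, hs, (hc hs).1.mul_mem hx (hst hy)⟩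
    · rintro x y ⟨s, hs, hx⟩ hxy
      exact ⟨s, hs, (hc hs).1.mem_of_le hx hxy⟩
    · rintro ⟨s, hs, hx⟩
      exact (hc hs).2 hx) {1} ⟨⟨rfl, by rintro x y rfl rfl; exact mul_one 1, by
        rintro x y rfl hy; exact le_antisymm (h.le_one y) hy⟩, ha⟩
  obtain ⟨hF1, haF⟩ := hF.prop
  -- `F` is maximal among filters omitting `a`, so adjoining any new `d` captures `a`.
  have key (d : A) (hd : d ∉ F) : ∃ u ∈ F, ∃ n : ℕ, u * d ^ n ≤ a := by
    by_contra hn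
    refine hd (hF.le_of_ge (y := {z | ∃ u ∈ F, ∃ n : ℕ, u * d ^ n ≤ z}) ⟨hF1.adjoin d, hn⟩
      (fun x hx => ⟨x, hx, 0, by simp⟩) ⟨1, hF1.one_mem, 1, by simp⟩)
  refine ⟨F, hF1, haF, fun x y => ?_⟩
  by_contra! hxy
  obtain ⟨u, hu, m, hm⟩ := key _ hxy.1
  obtain ⟨v, hv, n, hn⟩ := key _ hxy.2
  refine haF (hF1.mem_of_le (hF1.mul_mem hu hv) ?_)
  calc u * v = u * v * ((x ⇨ y) ^ m ⊔ (y ⇨ x) ^ n) := by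
        rw [h.pow_sup_pow_eq_one (h.himp_sup_himp x y), mul_one]
    _ = (u * (x ⇨ y) ^ m) * v ⊔ (v * (y ⇨ x) ^ n) * u := by
        rw [mul_sup, mul_right_comm, mul_right_comm v, mul_comm u v]
    _ ≤ a := sup_le ((mul_le_left_of_le_one (h.le_one _)).trans hm)
        ((mul_le_left_of_le_one (h.le_one _)).trans hn)

/-- The linearly ordered group attached to a prime filter: its elements are the formal fractions
over `A`, two fractions being identified if they differ by a quotient of members of the filter. -/
theorem exists_group_of_prime_filter {F : Set A} (hF : IsFilter F)
    (hP : ∀ x y, x ⇨ y ∈ F ∨ y ⇨ x ∈ F) :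
    ∃ (G : Type u) (_ : AddCommGroup G) (_ : LinearOrder G) (_ : IsOrderedAddMonoid G) (π : A → G),
      (∀ x y, π (x * y) = π x + π y) ∧ (∀ x, 0 ≤ π x) ∧ (∀ x, π x = 0 ↔ x ∈ F) := by
  classical
  let of : A →* Algebra.GrothendieckGroup A := Algebra.GrothendieckGroup.of
  have of_inj {x y : A} (e : of x = of y) : x = y := by
    obtain ⟨c, hc⟩ := ((Localization.monoidOf (⊤ : Submonoid A)).eq_iff_exists).1 e
    exact h.cancellative _ _ _ hc
  let N : Subgroup (Algebra.GrothendieckGroup A) :=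
    { carrier := {z | ∃ u ∈ F, ∃ v ∈ F, z * of u = of v}
      one_mem' := ⟨1, hF.one_mem, 1, hF.one_mem, one_mul _⟩
      mul_mem' := by
        rintro a b ⟨u, hu, v, hv, e⟩ ⟨u', hu', v', hv', e'⟩
        refine ⟨u * u', hF.mul_mem hu hu', v * v', hF.mul_mem hv hv', ?_⟩
        rw [map_mul, map_mul, mul_mul_mul_comm, e, e']
      inv_mem' := by
        rintro a ⟨u, hu, v, hv, e⟩
        exact ⟨v, hv, u, hu, by rw [← e, inv_mul_cancel_left]⟩ }
  let p : A →* Algebra.GrothendieckGroup A ⧸ N := (QuotientGroup.mk' N).comp of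
  -- If `x * u = v` with `u, v ∈ F`, then `v ≤ x`, so `x ∈ F`: the quotient kills exactly the
  -- filter.
  have p_eq_one {x : A} : p x = 1 ↔ x ∈ F := by
    refine (QuotientGroup.eq_one_iff (of x)).trans ⟨?_, fun hx => ⟨1, hF.one_mem, x, hx, ?_⟩⟩
    · rintro ⟨u, hu, v, hv, e⟩
      rw [← map_mul] at e
      exact hF.mem_of_le (of_inj e ▸ hv) (mul_le_left_of_le_one (h.le_one u))
    · rw [map_one, mul_one]
  -- The image of `A` is the positive cone, so the order of `A` is reversed and `1` goes to the
  -- least positive-cone element.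
  let C : GroupCone (Algebra.GrothendieckGroup A ⧸ N) :=
    { MonoidHom.mrange p with
      eq_one_of_mem_of_inv_mem' := by
        rintro _ ⟨x, rfl⟩ ⟨y, hy⟩
        refine p_eq_one.2 (hF.mem_of_le (p_eq_one.1 ?_) (mul_le_left_of_le_one (h.le_one y)))
        rw [map_mul, hy, mul_inv_cancel] }
  -- By divisibility the fraction `x / y` equals `(y ⇨ x) / (x ⇨ y)`; primeness makes its numerator
  -- or denominator trivial.
  have : HasMemOrInvMem C := ⟨fun z => by
    obtain ⟨z, rfl⟩ := QuotientGroup.mk'_surjective N z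
    obtain ⟨⟨x, y⟩, e⟩ := (Localization.monoidOf (⊤ : Submonoid A)).surj z
    have e1 : QuotientGroup.mk' N z * p y = p x := congrArg (QuotientGroup.mk' N) e
    have e2 : p x * p (x ⇨ y) = p y * p (y ⇨ x) := by
      rw [← map_mul, ← map_mul, h.divisible]
    have e3 : QuotientGroup.mk' N z * p (x ⇨ y) = p (y ⇨ x) := by
      apply mul_left_cancel (a := p y)
      rw [← e2, ← e1]
      ac_rfl
    rcases hP x y with hxy | hxy
    · exact Or.inl ⟨y ⇨ x, by rw [← e3, p_eq_one.2 hxy, mul_one]⟩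
    · exact Or.inr ⟨x ⇨ y, by rw [eq_inv_iff_mul_eq_one, mul_comm, e3, p_eq_one.2 hxy]⟩⟩
  let _ : LinearOrder (Algebra.GrothendieckGroup A ⧸ N) := LinearOrder.mkOfGroupCone C
  have : IsOrderedMonoid (Algebra.GrothendieckGroup A ⧸ N) := IsOrderedMonoid.mkOfCone C
  refine ⟨Additive (Algebra.GrothendieckGroup A ⧸ N), inferInstance, inferInstance, inferInstance,
    fun x => Additive.ofMul (p x), fun x y => congrArg Additive.ofMul (map_mul p x y), fun x => ?_, fun x => ?_⟩
  · change p x / 1 ∈ C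
    rw [div_one]
    exact ⟨x, rfl⟩
  · exact p_eq_one

/-- Every cancellative hoop is locally separated by maps to `C_ω`. -/
theorem locallySeparated_cOmega : LocallySeparated A COmega.{u} := by
  classical
  have key (T : Finset A) (a : A) (ha : a ≠ 1) :
      ∃ f : A → COmega.{u}, IsHomOn (T : Set A) f ∧ (a ∈ T → f a ≠ 1) := by
    obtain ⟨F, hF, haF, hP⟩ := h.exists_prime_filter ha
    obtain ⟨G, _, _, _, π, π_mul, π_nonneg, π_eq_zero⟩ := h.exists_group_of_prime_filter hF hP
    -- Including `0` makes `ψ` nonnegative on the image of `T` and positive at `π a` when `a ∈ T`.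
    let U : Finset G := insert 0 (T.image π)
    obtain ⟨ψ, hψ⟩ := exists_strictMonoOn_closure U
    -- The default `0` is never reached below: `π` sends `1`, members of `T` and the results of
    -- operations on them into the subgroup.
    let f (x : A) : COmega.{u} :=
      ⟨if hx : π x ∈ AddSubgroup.closure (U : Set G) then (ψ ⟨π x, hx⟩).toNat else 0⟩
    have π_one : π 1 = 0 := (π_eq_zero 1).2 hF.one_mem
    have f_congr {x y : A} (e : π x = π y) : f x = f y := by simp only [f, e]
    have mem_U {x : A} (hx : x ∈ T) : π x ∈ U :=
      Finset.mem_insert_of_mem (Finset.mem_image_of_mem _ hx)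
    have mem {x : A} (hx : x ∈ T) : π x ∈ AddSubgroup.closure (U : Set G) :=
      AddSubgroup.subset_closure (mem_U hx)
    have f_eq {x : A} (hx : π x ∈ AddSubgroup.closure (U : Set G)) :
        (f x).exp = (ψ ⟨π x, hx⟩).toNat := dif_pos hx
    have ψ_mono (s t : AddSubgroup.closure (U : Set G)) (hs : (s : G) ∈ U) (ht : (t : G) ∈ U)
        (hst : s ≤ t) : ψ s ≤ ψ t := by
      rcases hst.eq_or_lt with rfl | hst
      · exact le_rfl
      · exact (hψ s t hs ht hst).le
    have ψ_nonneg {x : A} (hx : x ∈ T) : 0 ≤ ψ ⟨π x, mem hx⟩ := by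
      have := ψ_mono 0 ⟨π x, mem hx⟩ (Finset.mem_insert_self _ _) (mem_U hx) (π_nonneg x)
      rwa [map_zero] at this
    have f_mono {x y : A} (hx : x ∈ T) (hy : y ∈ T) (hxy : π x ≤ π y) :
        (f x).exp ≤ (f y).exp := by
      rw [f_eq (mem hx), f_eq (mem hy)]
      exact Int.toNat_le_toNat (ψ_mono _ _ (mem_U hx) (mem_U hy) hxy)
    -- the operations, when the value of `π` at `x` is the larger one
    have large {x y : A} (hx : x ∈ T) (hy : y ∈ T) (hxy : x ⇨ y ∈ F) :
        (f y).exp ≤ (f x).exp ∧ f (x ⊔ y) = f y ∧ f (x ⊓ y) = f x ∧ (f (x ⇨ y)).exp = 0 ∧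
          (f (y ⇨ x)).exp = (f x).exp - (f y).exp := by
      have e0 : π (x ⇨ y) = 0 := (π_eq_zero _).2 hxy
      have e1 : π x = π y + π (y ⇨ x) := by
        rw [← π_mul, ← h.divisible, π_mul, e0, add_zero]
      have e2 : π (y ⇨ x) = π x - π y := by rw [e1, add_sub_cancel_left]
      have hle : π y ≤ π x := by rw [e1]; exact le_add_of_nonneg_right (π_nonneg _)
      refine ⟨f_mono hy hx hle, f_congr ?_, f_congr ?_, ?_, ?_⟩
      · conv_rhs => rw [← h.sup_mul_himp_right x y]
        rw [π_mul, e0, add_zero]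
      · rw [h.inf_eq, π_mul, e0, add_zero]
      · have hz : π (x ⇨ y) ∈ AddSubgroup.closure (U : Set G) := e0 ▸ zero_mem _
        rw [f_eq hz, show (⟨π (x ⇨ y), hz⟩ : AddSubgroup.closure (U : Set G)) = 0 from
          Subtype.ext e0, map_zero, Int.toNat_zero]
      · have hz : π (y ⇨ x) ∈ AddSubgroup.closure (U : Set G) :=
          e2 ▸ sub_mem (mem hx) (mem hy)
        have := ψ_nonneg hy
        rw [f_eq hz, f_eq (mem hx), f_eq (mem hy),
          show (⟨π (y ⇨ x), hz⟩ : AddSubgroup.closure (U : Set G)) =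
            ⟨π x, mem hx⟩ - ⟨π y, mem hy⟩ from Subtype.ext e2, map_sub]
        omega
    refine ⟨f, ⟨fun x hx y hy => ?_, fun x hx y hy => ?_, fun x hx y hy => ?_,
      fun x hx y hy => ?_, ?_⟩, fun haT => ?_⟩
    · rcases hP x y with hxy | hxy
      · obtain ⟨h1, h2, -⟩ := large hx hy hxy
        exact h2.trans (COmega.ext (min_eq_right h1).symm)
      · obtain ⟨h1, h2, -⟩ := large hy hx hxy
        exact (sup_comm x y ▸ h2).trans (COmega.ext (min_eq_left h1).symm)
    · rcases hP x y with hxy | hxy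
      · obtain ⟨h1, -, h2, -⟩ := large hx hy hxy
        exact h2.trans (COmega.ext (max_eq_left h1).symm)
      · obtain ⟨h1, -, h2, -⟩ := large hy hx hxy
        exact (inf_comm x y ▸ h2).trans (COmega.ext (max_eq_right h1).symm)
    · have hz : π (x * y) ∈ AddSubgroup.closure (U : Set G) :=
        π_mul x y ▸ add_mem (mem hx) (mem hy)
      refine COmega.ext ?_
      change (f (x * y)).exp = (f x).exp + (f y).exp
      rw [f_eq hz, f_eq (mem hx), f_eq (mem hy),
        show (⟨π (x * y), hz⟩ : AddSubgroup.closure (U : Set G)) =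
          ⟨π x, mem hx⟩ + ⟨π y, mem hy⟩ from Subtype.ext (π_mul x y), map_add,
        Int.toNat_add (ψ_nonneg hx) (ψ_nonneg hy)]
    · refine COmega.ext ?_
      change (f (x ⇨ y)).exp = (f y).exp - (f x).exp
      rcases hP x y with hxy | hxy
      · obtain ⟨h1, -, -, h2, -⟩ := large hx hy hxy
        omega
      · exact (large hy hx hxy).2.2.2.2
    · have hz : π 1 ∈ AddSubgroup.closure (U : Set G) := π_one ▸ zero_mem _
      refine COmega.ext ?_
      rw [f_eq hz, show (⟨π 1, hz⟩ : AddSubgroup.closure (U : Set G)) = 0 from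
        Subtype.ext π_one, map_zero]
      rfl
    · have hpos : 0 < π a := (π_nonneg a).lt_of_ne fun e => haF ((π_eq_zero a).1 e.symm)
      have := hψ 0 ⟨π a, mem haT⟩ (Finset.mem_insert_self _ _) (mem_U haT) hpos
      rw [map_zero] at this
      intro e
      have e : (f a).exp = 0 := congrArg COmega.exp e
      rw [f_eq (mem haT)] at e
      omega
  intro T x y hxy
  -- If both residuals were `1`, then `x = y`.
  wlog hne : x ⇨ y ≠ 1 generalizing x y
  · obtain ⟨f, hf, hfne⟩ := this y x hxy.symm fun e => hxy
      (le_antisymm (h.himp_eq_one_iff.1 (not_not.1 hne)) (h.himp_eq_one_iff.1 e))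
    exact ⟨f, hf, hfne.symm⟩
  -- With `x` and `y` in the set, `f (x ⇨ y) = f x ⇨ f y`, so `f x = f y` would force the excluded
  -- value `1`.
  obtain ⟨f, hf, hfa⟩ := key (T ∪ {x, y, x ⇨ y}) _ hne
  have hsub : (T : Set A) ⊆ ((T ∪ {x, y, x ⇨ y} : Finset A) : Set A) := by
    exact_mod_cast Finset.subset_union_left
  refine ⟨f, ⟨fun s hs t ht => hf.map_sup s (hsub hs) t (hsub ht),
    fun s hs t ht => hf.map_inf s (hsub hs) t (hsub ht),
    fun s hs t ht => hf.map_mul s (hsub hs) t (hsub ht),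
    fun s hs t ht => hf.map_himp s (hsub hs) t (hsub ht), hf.map_one⟩, fun e => ?_⟩
  refine hfa (by simp) ?_
  rw [hf.map_himp x (by simp) y (by simp), e, isCancHoop_cOmega.himp_eq_one_iff]

end IsCancHoop

/-- `K(C)` is generated by `K(C_ω)`. -/
theorem kClass_cancHoops_eq_var :
    KClass CancHoops.{u} = Var {(⟨KExp COmega.{u}⟩ : CRLat.{u})} := by
  apply Set.Subset.antisymm
  · intro A hA W hW hsub
    obtain ⟨hA1, hC⟩ := mem_kClass_cancHoops_iff.1 hA
    exact hW.sub A _ (hC.locallySeparated_cOmega.kExp.mem_of_isVariety hW (hsub rfl))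
      ⟨_, hA1.isHom_toKExp, hA1.toKExp_injective⟩
  · refine var_subset isVariety_kClass_cancHoops ?_
    rintro _ rfl
    exact kExp_mem_kClass isCancHoop_cOmega

/-- `K(C)` as a subvariety of the variety of K-lattices. -/
def kCancHoops : SubKL.{u} where
  carrier := KClass CancHoops
  isVariety := isVariety_kClass_cancHoops
  le_KL _ hA := hA.1

/-- A smaller subvariety with a nontrivial member would contain `K(C_ω)`, which generates all of
`K(C)`. -/
theorem isAtom_kCancHoops : IsAtom kCancHoops.{u} := by
  refine ⟨fun e => not_subsingleton_kExp_cOmega ?_, fun W hW => ?_⟩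
  · have e : KClass CancHoops = Triv := congrArg SubKL.carrier e
    have h : (⟨KExp COmega.{u}⟩ : CRLat.{u}) ∈ Triv := e ▸ kExp_mem_kClass isCancHoop_cOmega
    exact h
  · rw [eq_bot_iff]
    intro A hA
    by_contra hn
    refine hW.not_ge ?_
    change KClass CancHoops ⊆ W.carrier
    rw [kClass_cancHoops_eq_var]
    refine var_subset W.isVariety (Set.singleton_subset_iff.2 ?_)
    exact kExp_cOmega_mem W.isVariety hA (hW.le hA) (not_subsingleton_iff_nontrivial.1 hn)

end KLat

theorem mainTheorem2 :
    -- `K(C)` is a Kalman variety equal to `V(K(C_ω))`, a non finitely generated atom of `Λ(KL)`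
    (∃ W : KLat.SubKL.{u},
      W.carrier = KLat.KClass KLat.CancHoops.{u} ∧
      KLat.IsKalman W.carrier ∧
      W.carrier = KLat.Var {(⟨KLat.KExp KLat.COmega.{u}⟩ : KLat.CRLat.{u})} ∧
      IsAtom W ∧
      ¬ KLat.FinitelyGenerated W.carrier) ∧
    -- a K-lattice with cancellative negative cone is the full K-expansion of that cone
    (∀ (A : Type u) [KLat.CRL A], KLat.IsKLattice A → KLat.Cancellative (KLat.NegCone A) →
      ∃ f : A → KLat.KExp (KLat.NegCone A), KLat.IsHom f ∧ Function.Bijective f ∧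
        ∀ a : A, f a = ⟨⟨a ⊓ 1, inf_le_right⟩, ⟨KLat.neg a ⊓ 1, inf_le_right⟩⟩) ∧
    -- `C_ω` embeds in every nontrivial totally ordered cancellative hoop
    (∀ (A : Type u) [KLat.CRL A], KLat.IsCancHoop A → Nontrivial A →
      (∀ x y : A, x ≤ y ∨ y ≤ x) →
      ∃ f : KLat.COmega.{u} → A, KLat.IsHom f ∧ Function.Injective f) :=
  ⟨⟨KLat.kCancHoops, rfl, KLat.isKalman_kClass_cancHoops, KLat.kClass_cancHoops_eq_var,
    KLat.isAtom_kCancHoops, KLat.not_finitelyGenerated_kClass_cancHoops⟩,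
   fun _ _ hA hc => ⟨_, hA.isHom_toKExp, hA.toKExp_bijective hc, fun _ => rfl⟩,
   fun _ _ hA _ _ => hA.exists_embedding_cOmega⟩
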